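/- Consider the stable D/M/1 queue with the LIFO (last-come-first-served, non-preemptive) policy: one server, unlimited waiting space, clients $n=0,1,2,\dots$ arriving at times $na$ with constant interarrival time $a>0$, and service lengths that are independent and exponentially distributed with mean $1/\mu$, where $\mu>0$ and $a\mu>1$. Whenever the server becomes free, it takes the client present who arrived last (a client arriving at that very moment counts as present); if nobody is present, it serves the next client on arrival. At time $0$ there may be an arbitrary, possibly random, finite number of waiting clients and an arbitrary, possibly random, finite residual service time, jointly independent of the service lengths. Let $W_n$ be the waiting time in queue (prior to service) of the client arriving at time $na$. The equation $\zeta_0=e^{-a\mu(1-\zeta_0)}$ has exactly one root $\zeta_0$ in $(0,1)$. Let $f$ be the function that vanishes on $(-\infty,0]$ and satisfies, for each $k=0,1,2,\dots$, $$f(x)=\frac{1}{k!}\,\mu^{k+1}\,\zeta_0\,x^{k-1}(x-ka)\,e^{-\mu x}\qquad\text{for } ka<x<(k+1)a ;$$ the countably many values $f(ka)$, $k\ge 1$, are immaterial. In particular $f(x)=\mu\zeta_0e^{-\mu x}$ on $(0,a)$, and $f(x)\to 0$ as $x\downarrow ka$ for each $k\ge1$. Then almost surely every arriving client is eventually served,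 and the equilibrium distribution of the waiting time is $$\nu=(1-\zeta_0)\,\delta_0+f(x)\,dx ,$$ that is, it has an atom $1-\zeta_0$ at $0$ and density $f$ on $(0,\infty)$, in the following sense: 1. for every such initial state, $\mathbb P(W_n\in B)\to\nu(B)$ as $n\to\infty$ for every Borel set $B\subseteq\mathbb R$; 2. if the queue is in equilibrium, in the sense that $W_0,W_1,W_2,\dots$ all have the same distribution, then each $W_n$ has the distribution $\nu$. -/

import Mathlib

open MeasureTheory ProbabilityTheory Set Filter Topology

/-! ### The single-server LIFO queue with constant interarrival times

Clients are indexed by integers.  Client `i ≥ 0` arrives at time `i * a`.  At time `0` the server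
is still occupied for a time `r ≥ 0` with earlier work, and the clients `-1, …, -m`
are already waiting (`-m` being the one who arrived first).  Client `i` needs service of
length `s i`.  Service is not interrupted, and whenever the server becomes free it takes the
client who arrived last among those present. -/

/-- State of the queue at an epoch at which the server becomes free. -/
structure LIFOState where
  /-- the time at which the server becomes free -/
  free : ℝ
  /-- the clients whose service has been completed so far -/
  served : Finset ℤ

namespace LIFOState

/-- The clients present when the server becomes free (an arrival at that very moment counts). -/
noncomputable def present (a : ℝ) (m : ℕ) (σ : LIFOState) : Finset ℤ :=
  Finset.Icc (-(m : ℤ)) ⌊σ.free / a⌋ \ σ.served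

open Classical in
/-- The client served next: the one present who arrived last or, if nobody is present, the
next one to arrive. -/
noncomputable def next (a : ℝ) (m : ℕ) (σ : LIFOState) : ℤ :=
  if h : (σ.present a m).Nonempty then (σ.present a m).max' h else ⌊σ.free / a⌋ + 1

/-- The time at which the service of the next client begins: at once if the client is present,
otherwise on arrival. -/
noncomputable def start (a : ℝ) (m : ℕ) (σ : LIFOState) : ℝ :=
  max σ.free (σ.next a m * a)

/-- The state after the service of the next client. -/
noncomputable def step (a : ℝ) (m : ℕ) (s : ℤ → ℝ) (σ : LIFOState) : LIFOState where
  free := σ.start a m + s (σ.next a m)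
  served := insert (σ.next a m) σ.served

end LIFOState

namespace LIFOQueue

/-- The state of the queue when the `j`-th service (`j = 0, 1, 2, …`) is about to be assigned. -/
noncomputable def state (a : ℝ) (m : ℕ) (r : ℝ) (s : ℤ → ℝ) : ℕ → LIFOState
  | 0 => ⟨r, ∅⟩
  | j + 1 => (state a m r s j).step a m s

/-- The client who receives the `j`-th service. -/
noncomputable def client (a : ℝ) (m : ℕ) (r : ℝ) (s : ℤ → ℝ) (j : ℕ) : ℤ :=
  (state a m r s j).next a m

/-- The time at which the `j`-th service begins. -/
noncomputable def startTime (a : ℝ) (m : ℕ) (r : ℝ) (s : ℤ → ℝ) (j : ℕ) : ℝ :=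
  (state a m r s j).start a m

/-- The waiting time in queue (prior to service) of client `n`: the time from the arrival `n * a`
to the beginning of the service of client `n`.  (Each client is served at most once; the
value is meaningful only if client `n` is served at all.) -/
noncomputable def wait (a : ℝ) (m : ℕ) (r : ℝ) (s : ℤ → ℝ) (n : ℕ) : ℝ :=
  startTime a m r s (sInf {j | client a m r s j = n}) - n * a

end LIFOQueue

/-- The measure with an atom of mass `p` at `0` and the density `f` with respect to Lebesgue
measure. -/
noncomputable def atomPlusDensity (p : ℝ) (f : ℝ → ℝ) : Measure ℝ :=
  ENNReal.ofReal p • Measure.dirac 0 + volume.withDensity (fun x => ENNReal.ofReal (f x))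

/-! The LIFO rule picks the next client without looking at service lengths not yet used. Hence the
lengths, listed in the order of performance, are again independent exponentials, independent of the
initial state (`measure_past_inter_serviceLength`).

In that order the epochs at which the server becomes free satisfy F(j+1) = max(F(j), (j - m)a) +
u(j), exactly as under FIFO (`free_eq_freeTime`). So whether client n finds the server occupied,
that is na ≤ F(n+m), is a question about Lindley's recursion. Its invariant law Exp(μ(1 - ζ)) gives
the occupation probability ζ, and copies driven by the same services merge at a geometric rate, so
the probability tends to ζ from every start (`tendsto_occupiedProb`).

Suppose client n finds in progress a service of the queue. Its residual length is exponential by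
memorylessness, so the later service ends, measured from the arrival of n, are Poisson points t 0 <
t 1 < … while the server stays busy. Later arrivals overtake n, so n is taken at the first t k < (k
+ 1)a, when k services have absorbed the k arrivals after n (`client_of_le_free`). The density of t
k on the event that t i ≥ (i + 1)a for all i < k is `ballotDensity`, found by one integration per
service (`lintegral_staysAbove`); cut down to [ka, (k + 1)a) and summed over k, it is f / ζ.

This conditional law is exact for every n and every initial state (`measure_wait_inter_occupied`).
Only its weight converges, which is why the convergence holds on every Borel set. The initial
residual service need not be exponential, but it lasts until na with probability tending to 0. If
all waiting times have the same law, it must be the limit. Finally, no client waits forever, because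
by the law of large numbers the services last 1 / μ < a on average. -/

namespace LIFOState

/-! ### The selection rule at a single epoch -/

variable {a : ℝ} {m : ℕ} {σ : LIFOState}

lemma mem_present {i : ℤ} :
    i ∈ σ.present a m ↔ (-(m : ℤ) ≤ i ∧ i ≤ ⌊σ.free / a⌋) ∧ i ∉ σ.served := by
  simp [present]

lemma next_mem (h : (σ.present a m).Nonempty) : σ.next a m ∈ σ.present a m := by
  rw [next, dif_pos h]; exact Finset.max'_mem _ _

lemma le_next {i : ℤ} (h : i ∈ σ.present a m) : i ≤ σ.next a m := by
  rw [next, dif_pos ⟨i, h⟩]; exact Finset.le_max' _ _ h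

lemma next_of_empty (h : ¬ (σ.present a m).Nonempty) : σ.next a m = ⌊σ.free / a⌋ + 1 := by
  rw [next, dif_neg h]

lemma next_notMem_served (h : σ.served ⊆ Finset.Icc (-(m : ℤ)) ⌊σ.free / a⌋) :
    σ.next a m ∉ σ.served := by
  by_cases hp : (σ.present a m).Nonempty
  · exact (mem_present.1 (next_mem hp)).2
  · intro hmem
    have := (Finset.mem_Icc.1 (h hmem)).2
    rw [next_of_empty hp] at this
    omega

lemma neg_le_next (ha : 0 < a) (h0 : 0 ≤ σ.free) : -(m : ℤ) ≤ σ.next a m := by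
  by_cases hp : (σ.present a m).Nonempty
  · exact (mem_present.1 (next_mem hp)).1.1
  · rw [next_of_empty hp]
    have : (0 : ℤ) ≤ ⌊σ.free / a⌋ := Int.floor_nonneg.2 (by positivity)
    omega

end LIFOState

/-! ### The epochs of the queue, path by path -/

namespace LIFOQueue

open LIFOState

/-- The length of the `j`-th service, in the order in which the services are performed. -/
noncomputable def serviceLength (a : ℝ) (m : ℕ) (r : ℝ) (s : ℤ → ℝ) (j : ℕ) : ℝ :=
  s (client a m r s j)

/-- The time at which the `j`-th service may begin, as a function of the number `m` of initial
clients, the residual service time `r` and the service lengths `u` in order of performance. -/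
noncomputable def freeTime (a : ℝ) (m : ℕ) (r : ℝ) (u : ℕ → ℝ) : ℕ → ℝ
  | 0 => r
  | j + 1 => max (freeTime a m r u j) (((j : ℝ) - m) * a) + u j

variable {a : ℝ} {m : ℕ} {r : ℝ} {s : ℤ → ℝ}

lemma free_succ (j : ℕ) : (state a m r s (j + 1)).free =
    startTime a m r s j + serviceLength a m r s j := rfl

lemma served_succ (j : ℕ) : (state a m r s (j + 1)).served =
    insert (client a m r s j) (state a m r s j).served := rfl

lemma free_le_startTime (j : ℕ) : (state a m r s j).free ≤ startTime a m r s j := le_max_left _ _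

lemma client_mul_le_startTime (j : ℕ) : client a m r s j * a ≤ startTime a m r s j :=
  le_max_right _ _

lemma free_mono (hs : ∀ i, 0 ≤ s i) : Monotone fun j => (state a m r s j).free := by
  refine monotone_nat_of_le_succ fun j => ?_
  have h1 := free_le_startTime (a := a) (m := m) (r := r) (s := s) j
  have h2 : 0 ≤ serviceLength a m r s j := hs _
  simp only [free_succ]
  linarith

lemma free_nonneg (hs : ∀ i, 0 ≤ s i) (hr : 0 ≤ r) (j : ℕ) : 0 ≤ (state a m r s j).free :=
  hr.trans (free_mono hs (Nat.zero_le j))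

lemma startTime_le_free_succ (hs : ∀ i, 0 ≤ s i) (j : ℕ) :
    startTime a m r s j ≤ (state a m r s (j + 1)).free := by
  have h2 : 0 ≤ serviceLength a m r s j := hs _
  rw [free_succ]; linarith

lemma client_le_floor (ha : 0 < a) (hs : ∀ i, 0 ≤ s i) {i j : ℕ} (hij : i < j) :
    client a m r s i ≤ ⌊(state a m r s j).free / a⌋ := by
  rw [Int.le_floor, le_div_iff₀ ha]
  exact (client_mul_le_startTime i).trans
    ((startTime_le_free_succ hs i).trans (free_mono hs hij))

lemma mem_served_iff {i : ℤ} {j : ℕ} :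
    i ∈ (state a m r s j).served ↔ ∃ l < j, client a m r s l = i := by
  induction j with
  | zero => simp [state]
  | succ j ih =>
    rw [served_succ, Finset.mem_insert, ih]
    constructor
    · rintro (h | ⟨l, hl, h⟩)
      · exact ⟨j, by omega, h.symm⟩
      · exact ⟨l, by omega, h⟩
    · rintro ⟨l, hl, h⟩
      rcases Nat.lt_succ_iff_lt_or_eq.1 hl with hl | rfl
      · exact Or.inr ⟨l, hl, h⟩
      · exact Or.inl h.symm

lemma served_subset (ha : 0 < a) (hs : ∀ i, 0 ≤ s i) (hr : 0 ≤ r) (j : ℕ) :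
    (state a m r s j).served ⊆ Finset.Icc (-(m : ℤ)) ⌊(state a m r s j).free / a⌋ := by
  intro i hi
  obtain ⟨l, hl, rfl⟩ := mem_served_iff.1 hi
  exact Finset.mem_Icc.2 ⟨neg_le_next ha (free_nonneg hs hr l), client_le_floor ha hs hl⟩

lemma client_notMem_served (ha : 0 < a) (hs : ∀ i, 0 ≤ s i) (hr : 0 ≤ r) (j : ℕ) :
    client a m r s j ∉ (state a m r s j).served :=
  next_notMem_served (served_subset ha hs hr j)

lemma client_injective (ha : 0 < a) (hs : ∀ i, 0 ≤ s i) (hr : 0 ≤ r) :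
    Function.Injective (client a m r s) := by
  have key : ∀ i j, i < j → client a m r s i ≠ client a m r s j := fun i j hij h =>
    client_notMem_served ha hs hr j (mem_served_iff.2 ⟨i, hij, h⟩)
  intro i j h
  rcases lt_trichotomy i j with hij | hij | hij
  · exact absurd h (key i j hij)
  · exact hij
  · exact absurd h.symm (key j i hij)

lemma card_served (ha : 0 < a) (hs : ∀ i, 0 ≤ s i) (hr : 0 ≤ r) (j : ℕ) :
    (state a m r s j).served.card = j := by
  induction j with
  | zero => rfl
  | succ j ih =>
    rw [served_succ, Finset.card_insert_of_notMem (client_notMem_served ha hs hr j), ih]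

/-- Counting: `j` distinct clients have been served, all of them among the `m + ⌊free / a⌋ + 1`
clients who have come so far. Somebody is present exactly when the second number is larger;
otherwise the two agree. -/
lemma present_nonempty_or_empty (ha : 0 < a) (hs : ∀ i, 0 ≤ s i) (hr : 0 ≤ r) (j : ℕ) :
    (((state a m r s j).present a m).Nonempty ∧ (j : ℤ) - m ≤ ⌊(state a m r s j).free / a⌋) ∨
    (¬ ((state a m r s j).present a m).Nonempty ∧
      (j : ℤ) - m = ⌊(state a m r s j).free / a⌋ + 1) := by
  have hsub := served_subset (m := m) ha hs hr j
  have hcard := card_served (m := m) ha hs hr j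
  have hfl : (0 : ℤ) ≤ ⌊(state a m r s j).free / a⌋ :=
    Int.floor_nonneg.2 (div_nonneg (free_nonneg hs hr j) ha.le)
  by_cases hp : ((state a m r s j).present a m).Nonempty
  · refine Or.inl ⟨hp, ?_⟩
    obtain ⟨x, hx⟩ := hp
    rw [present, Finset.mem_sdiff] at hx
    have hlt : (state a m r s j).served ⊂ _ :=
      Finset.ssubset_iff_subset_ne.2 ⟨hsub, fun h => hx.2 (h ▸ hx.1)⟩
    have := Finset.card_lt_card hlt
    rw [hcard, Int.card_Icc] at this
    omega
  · refine Or.inr ⟨hp, ?_⟩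
    rw [Finset.not_nonempty_iff_eq_empty, present, Finset.sdiff_eq_empty_iff_subset] at hp
    have := Finset.card_le_card hp
    have h2 := Finset.card_le_card hsub
    rw [hcard, Int.card_Icc] at this h2
    omega

/-- Here the policy drops out: an idle server has served all clients up to `j - m - 1`, so it waits
for client `j - m`. -/
lemma startTime_eq (ha : 0 < a) (hs : ∀ i, 0 ≤ s i) (hr : 0 ≤ r) (j : ℕ) :
    startTime a m r s j = max (state a m r s j).free (((j : ℝ) - m) * a) := by
  rcases present_nonempty_or_empty (m := m) ha hs hr j with ⟨hp, hj⟩ | ⟨hp, hj⟩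
  · have h1 := (mem_present.1 (next_mem hp)).1.2
    rw [Int.le_floor, le_div_iff₀ ha] at h1 hj
    push_cast at hj
    rw [startTime, start, max_eq_left h1, max_eq_left hj]
  · rw [startTime, start, next_of_empty hp, ← hj]
    push_cast
    rfl

lemma free_eq_freeTime (ha : 0 < a) (hs : ∀ i, 0 ≤ s i) (hr : 0 ≤ r) (j : ℕ) :
    (state a m r s j).free = freeTime a m r (serviceLength a m r s) j := by
  induction j with
  | zero => rfl
  | succ j ih => rw [free_succ, startTime_eq ha hs hr, ih, freeTime]

lemma wait_eq_of_client_eq (ha : 0 < a) (hs : ∀ i, 0 ≤ s i) (hr : 0 ≤ r) {n j : ℕ}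
    (h : client a m r s j = n) : wait a m r s n = startTime a m r s j - n * a := by
  have : {j | client a m r s j = n} = {j} := by
    ext i
    exact ⟨fun hi => client_injective ha hs hr ((hi : _ = _).trans h.symm), fun hi => hi ▸ h⟩
  rw [wait, this, csInf_singleton]

/-- Only `n + m` clients come strictly before `n * a`, and all of them have been served, so client
`n` meets an empty system. -/
lemma client_of_free_lt (ha : 0 < a) (hs : ∀ i, 0 ≤ s i) (hr : 0 ≤ r) {n : ℕ}
    (h : (state a m r s (n + m)).free < n * a) :
    client a m r s (n + m) = n ∧ startTime a m r s (n + m) = n * a := by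
  have hfl : ⌊(state a m r s (n + m)).free / a⌋ < n := by
    rw [Int.floor_lt, div_lt_iff₀ ha]; exact_mod_cast h
  constructor
  · rcases present_nonempty_or_empty (m := m) ha hs hr (n + m) with ⟨hp, hj⟩ | ⟨hp, hj⟩
    · push_cast at hj; omega
    · rw [client, next_of_empty hp, ← hj]; push_cast; ring
  · rw [startTime_eq ha hs hr, max_eq_right]
    · push_cast; ring
    · push_cast; linarith

/-- If the server is occupied at the arrival of client `n`, and the `J`-th service is the first to
end after it, then client `n` is taken as soon as the number of completed services exceeds the
number of arrivals after `n`. -/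
lemma client_of_le_free (ha : 0 < a) (hs : ∀ i, 0 ≤ s i) (hr : 0 ≤ r) {n J i : ℕ}
    (hJ : J ≤ n + m) (hlt : ∀ l < J, (state a m r s l).free < n * a)
    (hle : n * a ≤ (state a m r s J).free)
    (hbusy : ∀ l < i, ((n : ℝ) + l + 1) * a ≤ (state a m r s (J + l)).free)
    (hfree : (state a m r s (J + i)).free < ((n : ℝ) + i + 1) * a) :
    client a m r s (J + i) = n ∧ startTime a m r s (J + i) = (state a m r s (J + i)).free := by
  -- These services start strictly before `n * a`, hence go to clients earlier than `n`; `J ≤ n + m`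
  -- keeps `(l - m) * a` below `n * a`.
  have hbefore : ∀ l < J, client a m r s l < n := by
    intro l hl
    have h1 := client_mul_le_startTime (a := a) (m := m) (r := r) (s := s) l
    rw [startTime_eq ha hs hr] at h1
    have h2 : max (state a m r s l).free (((l : ℝ) - m) * a) < n * a := by
      refine max_lt (hlt l hl) (mul_lt_mul_of_pos_right ?_ ha)
      have : (l : ℝ) < n + m := by exact_mod_cast hl.trans_le hJ
      linarith
    have h3 := lt_of_mul_lt_mul_right (h1.trans_lt h2) ha.le
    exact_mod_cast h3
  -- Pigeonhole: the `l + 1` clients `n + 1, …, n + l + 1` have arrived, but only `l` services were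
  -- assigned from the `J`-th on. One of these clients is therefore present and preferred to `n`.
  have hafter : ∀ l < i, (n : ℤ) < client a m r s (J + l) := by
    intro l
    induction l using Nat.strong_induction_on with
    | _ l ih =>
      intro hl
      by_contra hcon
      have hsub : Finset.Icc ((n : ℤ) + 1) (n + l + 1) ⊆
          (Finset.range l).image fun x => client a m r s (J + x) := by
        intro x hx
        rw [Finset.mem_Icc] at hx
        have hxs : x ∈ (state a m r s (J + l)).served := by
          by_contra hns
          have hfl : x ≤ ⌊(state a m r s (J + l)).free / a⌋ := by
            rw [Int.le_floor, le_div_iff₀ ha]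
            refine le_trans ?_ (hbusy l hl)
            refine mul_le_mul_of_nonneg_right ?_ ha.le
            exact_mod_cast hx.2
          have := le_next (mem_present.2 ⟨⟨by omega, hfl⟩, hns⟩ :
            x ∈ (state a m r s (J + l)).present a m)
          exact hcon (by rw [client]; omega)
        obtain ⟨y, hy, rfl⟩ := mem_served_iff.1 hxs
        have hyJ : J ≤ y := by
          by_contra hyJ
          have := hbefore y (by omega)
          omega
        exact Finset.mem_image.2 ⟨y - J, Finset.mem_range.2 (by omega), by
          rw [Nat.add_sub_cancel' hyJ]⟩
      have := (Finset.card_le_card hsub).trans Finset.card_image_le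
      rw [Int.card_Icc, Finset.card_range] at this
      omega
  have hnle : n * a ≤ (state a m r s (J + i)).free :=
    hle.trans (free_mono hs (Nat.le_add_right J i))
  have hnfl : (n : ℤ) ≤ ⌊(state a m r s (J + i)).free / a⌋ := by
    rw [Int.le_floor, le_div_iff₀ ha]; exact_mod_cast hnle
  have hflt : ⌊(state a m r s (J + i)).free / a⌋ < n + i + 1 := by
    rw [Int.floor_lt, div_lt_iff₀ ha]; exact_mod_cast hfree
  have hns : (n : ℤ) ∉ (state a m r s (J + i)).served := by
    rw [mem_served_iff]
    rintro ⟨l, hl, hln⟩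
    rcases lt_or_ge l J with h | h
    · exact (hbefore l h).ne hln
    · have := hafter (l - J) (by omega)
      rw [Nat.add_sub_cancel' h] at this
      exact this.ne' hln
  have hpres : (n : ℤ) ∈ (state a m r s (J + i)).present a m :=
    mem_present.2 ⟨⟨by omega, hnfl⟩, hns⟩
  -- The `i` services from the `J`-th on go to distinct clients among the at most `i` who arrived
  -- after `n`. So all of those are served, and `n` is the latest one present.
  have himage : (Finset.range i).image (fun x => client a m r s (J + x)) =
      Finset.Icc ((n : ℤ) + 1) (n + i) := by
    refine Finset.eq_of_subset_of_card_le ?_ ?_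
    · intro x hx
      obtain ⟨y, hy, rfl⟩ := Finset.mem_image.1 hx
      rw [Finset.mem_range] at hy
      have h1 := hafter y hy
      have h2 := client_le_floor (m := m) (r := r) ha hs (show J + y < J + i by omega)
      rw [Finset.mem_Icc]; omega
    · rw [Finset.card_image_of_injective, Int.card_Icc, Finset.card_range]
      · omega
      · exact (client_injective ha hs hr).comp (add_right_injective J)
  have hclient : client a m r s (J + i) = n := by
    refine le_antisymm ?_ (le_next hpres)
    by_contra hcon
    have hmem := mem_present.1 (next_mem ⟨_, hpres⟩)
    have h3 : client a m r s (J + i) ∈ Finset.Icc ((n : ℤ) + 1) (n + i) := by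
      rw [Finset.mem_Icc]
      have : client a m r s (J + i) ≤ ⌊(state a m r s (J + i)).free / a⌋ := hmem.1.2
      omega
    rw [← himage] at h3
    obtain ⟨y, hy, hyc⟩ := Finset.mem_image.1 h3
    have := client_injective ha hs hr hyc
    rw [Finset.mem_range] at hy
    omega
  refine ⟨hclient, ?_⟩
  have : startTime a m r s (J + i) =
      max (state a m r s (J + i)).free (client a m r s (J + i) * a) := rfl
  rw [this, hclient]
  exact max_eq_left (by exact_mod_cast hnle)

end LIFOQueue

/-! ### Measurability, and independence of the services in the order of performance -/

namespace LIFOQueue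

open LIFOState

/-- The choice of client is a function `G` of `⌊free / a⌋`, `m` and the served set. These range over
countable types with discrete σ-algebras, so `G` needs no separate analysis. -/
lemma measurable_queue_epoch (a : ℝ) (j : ℕ) :
    (Measurable fun p : ℕ × ℝ × (ℤ → ℝ) => (state a p.1 p.2.1 p.2.2 j).free) ∧
    (Measurable fun p : ℕ × ℝ × (ℤ → ℝ) => client a p.1 p.2.1 p.2.2 j) ∧
    (Measurable fun p : ℕ × ℝ × (ℤ → ℝ) => startTime a p.1 p.2.1 p.2.2 j) ∧
    (Measurable fun p : ℕ × ℝ × (ℤ → ℝ) => serviceLength a p.1 p.2.1 p.2.2 j) := by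
  classical
  let _ : MeasurableSpace (Finset ℤ) := ⊤
  have : DiscreteMeasurableSpace (Finset ℤ) := ⟨fun _ => trivial⟩
  let G : ℤ × ℕ × Finset ℤ → ℤ := fun q =>
    if h : (Finset.Icc (-(q.2.1 : ℤ)) q.1 \ q.2.2).Nonempty then
      (Finset.Icc (-(q.2.1 : ℤ)) q.1 \ q.2.2).max' h else q.1 + 1
  have hG : Measurable G := Measurable.of_discrete
  have main : ∀ j, (Measurable fun p : ℕ × ℝ × (ℤ → ℝ) => (state a p.1 p.2.1 p.2.2 j).free) →
      (Measurable fun p : ℕ × ℝ × (ℤ → ℝ) => (state a p.1 p.2.1 p.2.2 j).served) →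
      (Measurable fun p : ℕ × ℝ × (ℤ → ℝ) => client a p.1 p.2.1 p.2.2 j) ∧
      (Measurable fun p : ℕ × ℝ × (ℤ → ℝ) => startTime a p.1 p.2.1 p.2.2 j) ∧
      (Measurable fun p : ℕ × ℝ × (ℤ → ℝ) => serviceLength a p.1 p.2.1 p.2.2 j) := by
    intro j hf hsv
    have hc : Measurable fun p : ℕ × ℝ × (ℤ → ℝ) => client a p.1 p.2.1 p.2.2 j := by
      have h1 : (fun p : ℕ × ℝ × (ℤ → ℝ) => client a p.1 p.2.1 p.2.2 j) = fun p =>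
          G (⌊(state a p.1 p.2.1 p.2.2 j).free / a⌋, p.1, (state a p.1 p.2.1 p.2.2 j).served) := by
        funext p
        simp only [client, next, present, G]
        congr
      rw [h1]
      exact hG.comp ((Int.measurable_floor.comp (hf.div_const a)).prodMk
        (measurable_fst.prodMk hsv))
    refine ⟨hc, ?_, ?_⟩
    · have h2 : Measurable fun p : ℕ × ℝ × (ℤ → ℝ) => (client a p.1 p.2.1 p.2.2 j : ℝ) :=
        (Measurable.of_discrete (f := fun z : ℤ => (z : ℝ))).comp hc
      exact hf.max (h2.mul_const a)
    · have h3 : Measurable fun q : ℤ × (ℤ → ℝ) => q.2 q.1 :=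
        measurable_from_prod_countable_right fun i => measurable_pi_apply i
      exact h3.comp (hc.prodMk (measurable_snd.comp measurable_snd))
  have key : ∀ j, (Measurable fun p : ℕ × ℝ × (ℤ → ℝ) => (state a p.1 p.2.1 p.2.2 j).free) ∧
      (Measurable fun p : ℕ × ℝ × (ℤ → ℝ) => (state a p.1 p.2.1 p.2.2 j).served) := by
    intro j
    induction j with
    | zero =>
      exact ⟨measurable_fst.comp measurable_snd, measurable_const⟩
    | succ j ih =>
      obtain ⟨hc, hst, hsl⟩ := main j ih.1 ih.2
      refine ⟨hst.add hsl, ?_⟩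
      exact (Measurable.of_discrete (f := fun q : ℤ × Finset ℤ => insert q.1 q.2)).comp
        (hc.prodMk ih.2)
  exact ⟨(key j).1, main j (key j).1 (key j).2⟩

lemma measurable_wait (a : ℝ) (n : ℕ) :
    Measurable fun p : ℕ × ℝ × (ℤ → ℝ) => wait a p.1 p.2.1 p.2.2 n := by
  have hc := fun j => (measurable_queue_epoch a j).2.1
  have hset : ∀ j, MeasurableSet {p : ℕ × ℝ × (ℤ → ℝ) | client a p.1 p.2.1 p.2.2 j = n} :=
    fun j => hc j (measurableSet_singleton _)
  have hinf : Measurable fun p : ℕ × ℝ × (ℤ → ℝ) =>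
      sInf {j | client a p.1 p.2.1 p.2.2 j = n} := by
    refine measurable_of_Iic fun k => ?_
    -- If client `n` is never served, the infimum is `sInf ∅ = 0`, which lies in every `Iic k`; the
    -- second set accounts for this.
    have : (fun p : ℕ × ℝ × (ℤ → ℝ) => sInf {j | client a p.1 p.2.1 p.2.2 j = n}) ⁻¹' Iic k =
        (⋃ j ∈ Iic k, {p | client a p.1 p.2.1 p.2.2 j = n}) ∪
        ⋂ j, {p | client a p.1 p.2.1 p.2.2 j = n}ᶜ := by
      ext p
      simp only [mem_preimage, mem_Iic, mem_union, mem_iUnion, mem_ofPred_eq, mem_iInter,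
        mem_compl_iff, exists_prop]
      constructor
      · intro h
        by_cases hne : {j | client a p.1 p.2.1 p.2.2 j = n}.Nonempty
        · exact Or.inl ⟨_, h, Nat.sInf_mem hne⟩
        · exact Or.inr fun j hj => hne ⟨j, hj⟩
      · rintro (⟨j, hj, h⟩ | h)
        · exact (Nat.sInf_le h).trans hj
        · have : {j | client a p.1 p.2.1 p.2.2 j = n} = ∅ := by
            ext j; simpa using h j
          simp [this]
    rw [this]
    exact (MeasurableSet.biUnion (to_countable _) fun j _ => hset j).union
      (MeasurableSet.iInter fun j => (hset j).compl)
  have h1 : Measurable fun q : ℕ × (ℕ × ℝ × (ℤ → ℝ)) => startTime a q.2.1 q.2.2.1 q.2.2.2 q.1 :=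
    measurable_from_prod_countable_right fun j => (measurable_queue_epoch a j).2.2.1
  exact (h1.comp (hinf.prodMk measurable_id)).sub_const _

/-- The initial state and the lengths of the first `n` services. -/
noncomputable def past (a : ℝ) (n : ℕ) (p : ℕ × ℝ × (ℤ → ℝ)) : (ℕ × ℝ) × (ℕ → ℝ) :=
  ((p.1, p.2.1), fun i => if i < n then serviceLength a p.1 p.2.1 p.2.2 i else 0)

lemma measurable_past (a : ℝ) (n : ℕ) : Measurable (past a n) := by
  refine (measurable_fst.prodMk (measurable_fst.comp measurable_snd)).prodMk
    (measurable_pi_lambda _ fun i => ?_)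
  by_cases h : i < n
  · simp only [h, if_true]
    exact (measurable_queue_epoch a i).2.2.2
  · simp only [h, if_false]
    exact measurable_const

section update

variable {a : ℝ} {m : ℕ} {r : ℝ} {s : ℤ → ℝ} {n : ℕ} {c : ℤ}

/-- The service length of a client has no influence before that service has been given. -/
lemma state_update (v : ℝ) (h : ∀ i < n, client a m r s i ≠ c) {j : ℕ} (hj : j ≤ n) :
    state a m r (Function.update s c v) j = state a m r s j := by
  induction j with
  | zero => rfl
  | succ j ih =>
    have ih := ih (by omega)
    have hne : (state a m r s j).next a m ≠ c := h j (by omega)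
    simp only [state, ih, step, Function.update_of_ne hne]

lemma client_update (v : ℝ) (h : ∀ i < n, client a m r s i ≠ c) {j : ℕ} (hj : j ≤ n) :
    client a m r (Function.update s c v) j = client a m r s j := by
  rw [client, state_update v h hj, client]

lemma past_update (v : ℝ) (h : ∀ i < n, client a m r s i ≠ c) :
    past a n (m, r, Function.update s c v) = past a n (m, r, s) := by
  simp only [past, Prod.mk.injEq, true_and]
  funext i
  by_cases hi : i < n
  · simp only [hi, if_true, serviceLength]
    rw [client_update v h hi.le, Function.update_of_ne (h i hi)]
  · simp [hi]

lemma client_ne_of_client_eq (ha : 0 < a) (hs : ∀ i, 0 ≤ s i) (hr : 0 ≤ r)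
    (hc : client a m r s n = c) : ∀ i < n, client a m r s i ≠ c := fun _ hi h =>
  hi.ne (client_injective ha hs hr (h.trans hc.symm))

/-- Who receives the `n`-th service, and the past of that epoch, do not depend on the service
length of that client. -/
lemma client_update_eq_iff (ha : 0 < a) (hs : ∀ i, 0 ≤ s i) (hr : 0 ≤ r) :
    client a m r (Function.update s c 0) n = c ↔ client a m r s n = c := by
  have hs' : ∀ i, 0 ≤ Function.update s c 0 i := by
    intro i
    by_cases hi : i = c
    · subst hi; simp
    · rw [Function.update_of_ne hi]; exact hs i
  constructor
  · intro h
    -- Putting `s c` back into the modified sequence recovers `s`, so the forward argument also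
    -- gives the converse.
    have h1 := client_update (s c) (client_ne_of_client_eq ha hs' hr h) le_rfl
    rw [Function.update_idem, Function.update_eq_self] at h1
    exact h1.trans h
  · intro h
    exact (client_update 0 (client_ne_of_client_eq ha hs hr h) le_rfl).trans h

end update

variable {Ω : Type*} [MeasurableSpace Ω] {P : Measure Ω}

/-- Both hypotheses together say that the joint law of the triple is a product; associativity of
product measures regroups it. -/
lemma indepFun_prodMk_left [IsProbabilityMeasure P] {α β γ : Type*} [MeasurableSpace α] [MeasurableSpace β]
    [MeasurableSpace γ] {X : Ω → α} {Y : Ω → β} {Z : Ω → γ} (hX : Measurable X)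
    (hY : Measurable Y) (hZ : Measurable Z) (hXYZ : IndepFun X (fun ω => (Y ω, Z ω)) P)
    (hYZ : IndepFun Y Z P) : IndepFun (fun ω => (X ω, Y ω)) Z P := by
  have hXY : IndepFun X Y P := hXYZ.comp measurable_id measurable_fst
  rw [indepFun_iff_map_prod_eq_prod_map_map hX.aemeasurable (hY.prodMk hZ).aemeasurable,
    hYZ.map_prod_eq_prod_map_map hY.aemeasurable hZ.aemeasurable] at hXYZ
  rw [indepFun_iff_map_prod_eq_prod_map_map (hX.prodMk hY).aemeasurable hZ.aemeasurable,
    hXY.map_prod_eq_prod_map_map hX.aemeasurable hY.aemeasurable]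
  have : IsProbabilityMeasure (P.map X) := Measure.isProbabilityMeasure_map hX.aemeasurable
  have : IsProbabilityMeasure (P.map Y) := Measure.isProbabilityMeasure_map hY.aemeasurable
  have : IsProbabilityMeasure (P.map Z) := Measure.isProbabilityMeasure_map hZ.aemeasurable
  apply MeasurableEquiv.prodAssoc.map_measurableEquiv_injective
  rw [Measure.prodAssoc_prod, ← hXYZ,
    Measure.map_map MeasurableEquiv.prodAssoc.measurable ((hX.prodMk hY).prodMk hZ)]
  rfl

lemma indepFun_update [IsProbabilityMeasure P] {β : Type*} [MeasurableSpace β] {X : Ω → β} {S : ℤ → Ω → ℝ}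
    (hX : Measurable X) (hS : ∀ i, Measurable (S i)) (hindep : iIndepFun S P)
    (hXS : IndepFun X (fun ω i => S i ω) P) (c : ℤ) :
    IndepFun (fun ω => (X ω, Function.update (fun i => S i ω) c 0)) (S c) P := by
  have hSm : Measurable fun ω i => S i ω := measurable_pi_lambda _ hS
  have hup : Measurable fun s : ℤ → ℝ => Function.update s c 0 := by
    refine measurable_pi_lambda _ fun i => ?_
    by_cases hi : i = c
    · subst hi; simp
    · simp only [Function.update_of_ne hi]; exact measurable_pi_apply i
  have hY := hup.comp hSm
  have hYZ : IndepFun (fun ω => Function.update (fun i => S i ω) c 0) (S c) P := by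
    have h1 := indep_iSup_of_disjoint (fun i => (hS i).comap_le) hindep.iIndep
      (show Disjoint ({c}ᶜ : Set ℤ) {c} from disjoint_compl_left)
    rw [IndepFun_iff_Indep]
    refine indep_of_indep_of_le_left (indep_of_indep_of_le_right h1 ?_) ?_
    · exact le_iSup₂_of_le c rfl le_rfl
    · rw [← measurable_iff_comap_le]
      refine @measurable_pi_lambda _ _ _ (_) _ _ fun i => ?_
      by_cases hi : i = c
      · subst hi; simp
      · simp only [Function.update_of_ne hi]
        rw [measurable_iff_comap_le]
        exact le_iSup₂_of_le (f := fun i (_ : i ∈ ({c}ᶜ : Set ℤ)) =>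
          MeasurableSpace.comap (S i) inferInstance) i hi le_rfl
  have hXY : IndepFun X (fun ω => (Function.update (fun i => S i ω) c 0, S c ω)) P :=
    hXS.comp measurable_id (hup.prodMk (measurable_pi_apply c))
  exact indepFun_prodMk_left hX hY (hS c) hXY hYZ

/-- If `C` selects an index and the event `E ∩ {C = c}` is independent of `S c` for every `c`, then
`E` is independent of the selected variable `S C`. -/
lemma measure_inter_selected {S : ℤ → Ω → ℝ} (hS : ∀ i, Measurable (S i)) {ν : Measure ℝ}
    (hlaw : ∀ i, P.map (S i) = ν) {C : Ω → ℤ} (hC : Measurable C)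
    (hU : Measurable fun ω => S (C ω) ω) {E : Set Ω} (hE : MeasurableSet E)
    (hind : ∀ c, ∃ (β : Type) (_ : MeasurableSpace β) (Y : Ω → β) (D : Set β),
      IndepFun Y (S c) P ∧ MeasurableSet D ∧ ∀ᵐ ω ∂P, (ω ∈ E ∧ C ω = c) ↔ Y ω ∈ D)
    {B : Set ℝ} (hB : MeasurableSet B) :
    P (E ∩ (fun ω => S (C ω) ω) ⁻¹' B) = P E * ν B := by
  have hfib : ∀ E : Set Ω, MeasurableSet E → P E = ∑' c, P (E ∩ C ⁻¹' {c}) := by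
    intro E hE
    have h := measure_iUnion (μ := P) (f := fun c => E ∩ C ⁻¹' {c})
      (fun c d hcd => disjoint_left.2 fun ω h1 h2 => hcd (h1.2.symm.trans h2.2))
      (fun c => hE.inter (hC (measurableSet_singleton c)))
    rw [← h]
    congr 1
    ext ω
    simp
  rw [hfib _ (hE.inter (hU hB)), hfib _ hE, ← ENNReal.tsum_mul_right]
  refine tsum_congr fun c => ?_
  obtain ⟨β, _, Y, D, hY, hD, heq⟩ := hind c
  have h1 : P (E ∩ (fun ω => S (C ω) ω) ⁻¹' B ∩ C ⁻¹' {c}) = P (Y ⁻¹' D ∩ S c ⁻¹' B) := by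
    refine measure_congr (eventuallyEq_set.2 ?_)
    filter_upwards [heq] with ω hω
    simp only [mem_inter_iff, mem_preimage, ← hω, mem_singleton_iff]
    constructor
    · rintro ⟨⟨h1, h2⟩, h3⟩
      exact ⟨⟨h1, h3⟩, h3 ▸ h2⟩
    · rintro ⟨⟨h1, h3⟩, h2⟩
      exact ⟨⟨h1, h3.symm ▸ h2⟩, h3⟩
  have h2 : P (E ∩ C ⁻¹' {c}) = P (Y ⁻¹' D) := by
    refine measure_congr (eventuallyEq_set.2 ?_)
    filter_upwards [heq] with ω hω
    exact hω
  rw [h1, h2, hY.measure_inter_preimage_eq_mul _ _ hD hB, ← hlaw c, Measure.map_apply (hS c) hB]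

/-- The services, in the order of performance, have independent lengths: the `n`-th is
independent of the initial state and of the earlier ones, and has the common law. -/
theorem measure_past_inter_serviceLength [IsProbabilityMeasure P] {a : ℝ} (ha : 0 < a) {M : Ω → ℕ} {R : Ω → ℝ}
    {S : ℤ → Ω → ℝ} (hM : Measurable M) (hR : Measurable R) (hS : ∀ i, Measurable (S i))
    (hindep : iIndepFun S P) {ν : Measure ℝ} (hlaw : ∀ i, P.map (S i) = ν)
    (hXS : IndepFun (fun ω => (M ω, R ω)) (fun ω i => S i ω) P)
    (hS0 : ∀ᵐ ω ∂P, ∀ i, 0 ≤ S i ω) (hR0 : ∀ ω, 0 ≤ R ω) (n : ℕ)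
    {A : Set ((ℕ × ℝ) × (ℕ → ℝ))} (hA : MeasurableSet A) {B : Set ℝ} (hB : MeasurableSet B) :
    P ((fun ω => past a n (M ω, R ω, fun i => S i ω)) ⁻¹' A ∩
        (fun ω => serviceLength a (M ω) (R ω) (fun i => S i ω) n) ⁻¹' B) =
      P ((fun ω => past a n (M ω, R ω, fun i => S i ω)) ⁻¹' A) * ν B := by
  have hp : Measurable fun ω => (M ω, R ω, fun i => S i ω) :=
    hM.prodMk (hR.prodMk (measurable_pi_lambda _ hS))
  refine measure_inter_selected hS hlaw ((measurable_queue_epoch a n).2.1.comp hp)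
    ((measurable_queue_epoch a n).2.2.2.comp hp) ((measurable_past a n).comp hp hA)
    (fun c => ?_) hB
  have hre : Measurable fun q : (ℕ × ℝ) × (ℤ → ℝ) => (q.1.1, q.1.2, q.2) :=
    MeasurableEquiv.prodAssoc.measurable
  have hD1 : MeasurableSet ((fun q : (ℕ × ℝ) × (ℤ → ℝ) => past a n (q.1.1, q.1.2, q.2)) ⁻¹' A) :=
    (measurable_past a n).comp hre hA
  have hD2 : MeasurableSet ((fun q : (ℕ × ℝ) × (ℤ → ℝ) => client a q.1.1 q.1.2 q.2 n) ⁻¹' {c}) :=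
    (measurable_queue_epoch a n).2.1.comp hre (measurableSet_singleton c)
  -- On the event that `c` is chosen, the past does not change when the length of `c` is reset to 0.
  -- It is then a function of data independent of `S c`.
  refine ⟨_, _, _, _, indepFun_update (hM.prodMk hR) hS hindep hXS c, hD1.inter hD2, ?_⟩
  filter_upwards [hS0] with ω hω
  change (past a n (M ω, R ω, fun i => S i ω) ∈ A ∧
      client a (M ω) (R ω) (fun i => S i ω) n = c) ↔
    (past a n (M ω, R ω, Function.update (fun i => S i ω) c 0) ∈ A ∧
      client a (M ω) (R ω) (Function.update (fun i => S i ω) c 0) n = c)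
  rw [client_update_eq_iff ha hω (hR0 ω)]
  refine and_congr_left fun h => ?_
  rw [past_update 0 (client_ne_of_client_eq ha hω (hR0 ω) h)]

/-- The information in the initial state and in the first `n` services. -/
noncomputable def pastFiltration (a : ℝ) {M : Ω → ℕ} {R : Ω → ℝ} {S : ℤ → Ω → ℝ}
    (hM : Measurable M) (hR : Measurable R) (hS : ∀ i, Measurable (S i)) :
    Filtration ℕ ‹MeasurableSpace Ω› where
  seq n := MeasurableSpace.comap (fun ω => past a n (M ω, R ω, fun i => S i ω)) inferInstance
  mono' := by
    intro n k hnk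
    have h : Measurable fun q : (ℕ × ℝ) × (ℕ → ℝ) => (q.1, fun i => if i < n then q.2 i else 0) := by
      refine measurable_fst.prodMk (measurable_pi_lambda _ fun i => ?_)
      by_cases hi : i < n
      · simp only [hi, if_true]; exact (measurable_pi_apply i).comp measurable_snd
      · simp only [hi, if_false]; exact measurable_const
    have h2 : (fun ω => past a n (M ω, R ω, fun i => S i ω)) =
        (fun q : (ℕ × ℝ) × (ℕ → ℝ) => (q.1, fun i => if i < n then q.2 i else 0)) ∘
          fun ω => past a k (M ω, R ω, fun i => S i ω) := by
      funext ω
      simp only [past, Function.comp_apply, Prod.mk.injEq, true_and]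
      funext i
      by_cases hi : i < n
      · simp [hi, hi.trans_le hnk]
      · simp [hi]
    rw [← measurable_iff_comap_le, h2]
    exact h.comp (comap_measurable _)
  le' n := by
    rw [← measurable_iff_comap_le]
    exact (measurable_past a n).comp (hM.prodMk (hR.prodMk (measurable_pi_lambda _ hS)))

end LIFOQueue

/-! ### Integrals against exponential laws -/

section ExponentialConvolution

open scoped ENNReal

/-- Freezing: `U` is integrated out while the `𝓖`-measurable `Z` and `Y` are held fixed. Every later
use of the independence of a service from the past goes through this form. -/
lemma lintegral_mul_comp_of_indep {Ω : Type*} {𝓖 mΩ : MeasurableSpace Ω} {P : Measure Ω}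
    [IsProbabilityMeasure P] (h𝓖 : 𝓖 ≤ mΩ)
    {U : Ω → ℝ} (hU : Measurable U)
    (hind : Indep 𝓖 (MeasurableSpace.comap U inferInstance) P) {Z : Ω → ℝ≥0∞}
    (hZ : Measurable[𝓖] Z) {Y : Ω → ℝ} (hY : Measurable[𝓖] Y) {g : ℝ → ℝ → ℝ≥0∞}
    (hg : Measurable (Function.uncurry g)) :
    ∫⁻ ω, Z ω * g (Y ω) (U ω) ∂P = ∫⁻ ω, Z ω * ∫⁻ u, g (Y ω) u ∂(P.map U) ∂P := by
  have hZY : Measurable[𝓖] fun ω => (Z ω, Y ω) := hZ.prodMk hY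
  have hZY' : Measurable fun ω => (Z ω, Y ω) := hZY.mono h𝓖 le_rfl
  have hif : IndepFun (fun ω => (Z ω, Y ω)) U P := by
    rw [IndepFun_iff_Indep]
    exact indep_of_indep_of_le_left hind (measurable_iff_comap_le.1 hZY)
  have hmap := hif.map_prod_eq_prod_map_map hZY'.aemeasurable hU.aemeasurable
  have : IsProbabilityMeasure (P.map U) := Measure.isProbabilityMeasure_map hU.aemeasurable
  have hG : Measurable fun q : (ℝ≥0∞ × ℝ) × ℝ => q.1.1 * g q.1.2 q.2 :=
    (measurable_fst.comp measurable_fst).mul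
      (hg.comp ((measurable_snd.comp measurable_fst).prodMk measurable_snd))
  have h1 := lintegral_map (μ := P) hG (hZY'.prodMk hU)
  rw [hmap, lintegral_prod _ hG.aemeasurable, lintegral_map hG.lintegral_prod_right' hZY'] at h1
  rw [← h1]
  refine lintegral_congr fun ω => ?_
  exact lintegral_const_mul _ (hg.comp (measurable_const.prodMk measurable_id))

lemma lintegral_expMeasure (μ : ℝ) (g : ℝ → ℝ≥0∞) (hg : Measurable g) :
    ∫⁻ u, g u ∂expMeasure μ = ∫⁻ u in Ici 0, ENNReal.ofReal (μ * Real.exp (-(μ * u))) * g u := by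
  have hm : Measurable (exponentialPDF μ) := (measurable_exponentialPDFReal μ).ennreal_ofReal
  have : expMeasure μ = volume.withDensity (exponentialPDF μ) := rfl
  rw [this, lintegral_withDensity_eq_lintegral_mul _ hm hg, ← lintegral_indicator measurableSet_Ici]
  refine lintegral_congr fun u => ?_
  by_cases hu : 0 ≤ u
  · rw [indicator_of_mem (mem_Ici.2 hu), Pi.mul_apply, exponentialPDF_of_nonneg hu]
  · rw [indicator_of_notMem (by simpa using hu), Pi.mul_apply,
      exponentialPDF_of_neg (not_le.1 hu), zero_mul]

lemma lintegral_Ici_comp_sub (c : ℝ) {f : ℝ → ℝ≥0∞} :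
    ∫⁻ x in Ici c, f (x - c) = ∫⁻ x in Ici 0, f x := by
  rw [← lintegral_indicator measurableSet_Ici, ← lintegral_indicator measurableSet_Ici,
    ← lintegral_sub_right_eq_self ((Ici 0).indicator f) c]
  refine lintegral_congr fun x => ?_
  by_cases h : c ≤ x
  · rw [indicator_of_mem (mem_Ici.2 h), indicator_of_mem (by simpa using h)]
  · rw [indicator_of_notMem (by simpa using h), indicator_of_notMem (by simpa using h)]

lemma lintegral_add_expMeasure (μ x : ℝ) {g : ℝ → ℝ≥0∞} (hg : Measurable g) :
    ∫⁻ u, g (x + u) ∂expMeasure μ =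
      ∫⁻ y in Ici x, ENNReal.ofReal (μ * Real.exp (-(μ * (y - x)))) * g y := by
  rw [lintegral_expMeasure μ (fun u => g (x + u)) (hg.comp (measurable_const_add x)),
    ← lintegral_Ici_comp_sub x]
  simp

/-- Tonelli on the region `c ≤ x ≤ y`: the density `p` on `[c, ∞)` is convolved with the exponential
density. -/
lemma lintegral_mul_lintegral_add_expMeasure (μ c : ℝ) {p g : ℝ → ℝ≥0∞} (hp : Measurable p)
    (hg : Measurable g) :
    ∫⁻ x in Ici c, p x * ∫⁻ u, g (x + u) ∂expMeasure μ =
      ∫⁻ y in Ici c,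
        (∫⁻ x in Icc c y, p x * ENNReal.ofReal (μ * Real.exp (-(μ * (y - x))))) * g y := by
  have hk : Measurable fun q : ℝ × ℝ => ENNReal.ofReal (μ * Real.exp (-(μ * (q.2 - q.1)))) := by
    fun_prop
  let K : ℝ → ℝ → ℝ≥0∞ := fun x y => ({q : ℝ × ℝ | c ≤ q.1 ∧ q.1 ≤ q.2}).indicator
    (fun q => p q.1 * ENNReal.ofReal (μ * Real.exp (-(μ * (q.2 - q.1)))) * g q.2) (x, y)
  have hset : MeasurableSet {q : ℝ × ℝ | c ≤ q.1 ∧ q.1 ≤ q.2} :=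
    (measurableSet_le measurable_const measurable_fst).inter
      (measurableSet_le measurable_fst measurable_snd)
  have hK : Measurable (Function.uncurry K) :=
    (((hp.comp measurable_fst).mul hk).mul (hg.comp measurable_snd)).indicator hset
  have hL : ∫⁻ x in Ici c, p x * ∫⁻ u, g (x + u) ∂expMeasure μ = ∫⁻ x, ∫⁻ y, K x y := by
    rw [← lintegral_indicator measurableSet_Ici]
    refine lintegral_congr fun x => ?_
    by_cases hx : c ≤ x
    · rw [indicator_of_mem (mem_Ici.2 hx), lintegral_add_expMeasure μ x hg,
        ← lintegral_const_mul _ (by fun_prop), ← lintegral_indicator measurableSet_Ici]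
      refine lintegral_congr fun y => ?_
      by_cases hy : x ≤ y
      · simp only [K]
        rw [indicator_of_mem (mem_Ici.2 hy), indicator_of_mem (by exact ⟨hx, hy⟩), mul_assoc]
      · simp only [K]
        rw [indicator_of_notMem (by simpa using hy), indicator_of_notMem (fun h => hy h.2)]
    · rw [indicator_of_notMem (by simpa using hx)]
      simp only [K]
      rw [eq_comm, lintegral_eq_zero_iff (by exact hK.comp measurable_prodMk_left)]
      exact Eventually.of_forall fun y => indicator_of_notMem (fun h => hx h.1) _
  rw [hL, lintegral_lintegral_swap hK.aemeasurable, ← lintegral_indicator measurableSet_Ici]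
  refine lintegral_congr fun y => ?_
  have hzero : ∀ x, x ∉ Icc c y → K x y = 0 := fun x hx =>
    indicator_of_notMem (s := {q : ℝ × ℝ | c ≤ q.1 ∧ q.1 ≤ q.2}) hx _
  by_cases hy : c ≤ y
  · rw [indicator_of_mem (mem_Ici.2 hy), ← lintegral_mul_const _ (by fun_prop),
      ← lintegral_indicator measurableSet_Icc]
    refine lintegral_congr fun x => ?_
    by_cases hx : x ∈ Icc c y
    · rw [indicator_of_mem hx]
      exact indicator_of_mem (s := {q : ℝ × ℝ | c ≤ q.1 ∧ q.1 ≤ q.2}) hx _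
    · rw [indicator_of_notMem hx, hzero x hx]
  · rw [indicator_of_notMem (by simpa using hy), lintegral_eq_zero_iff (by
      exact hK.comp measurable_prodMk_right)]
    exact Eventually.of_forall fun x => hzero x fun h => hy (h.1.trans h.2)

lemma lintegral_Icc_of_hasDerivAt {H h : ℝ → ℝ} {c y : ℝ} (hcy : c ≤ y)
    (hderiv : ∀ x ∈ Icc c y, HasDerivAt H (h x) x) (hcont : ContinuousOn h (Icc c y))
    (hnonneg : ∀ x ∈ Icc c y, 0 ≤ h x) :
    ∫⁻ x in Icc c y, ENNReal.ofReal (h x) = ENNReal.ofReal (H y - H c) := by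
  have hii : IntervalIntegrable h volume c y := by
    rw [← uIcc_of_le hcy] at hcont
    exact hcont.intervalIntegrable
  rw [← intervalIntegral.integral_eq_sub_of_hasDerivAt (by rwa [uIcc_of_le hcy]) hii,
    intervalIntegral.integral_of_le hcy, ← integral_Icc_eq_integral_Ioc,
    ofReal_integral_eq_lintegral_ofReal]
  · exact hcont.integrableOn_Icc
  · exact (ae_restrict_iff' measurableSet_Icc).2 (Eventually.of_forall hnonneg)

lemma measurable_lintegral_add (ν : Measure ℝ) [SFinite ν] {g : ℝ → ℝ≥0∞} (hg : Measurable g) :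
    Measurable fun y => ∫⁻ u, g (y + u) ∂ν :=
  Measurable.lintegral_prod_right' (f := fun q : ℝ × ℝ => g (q.1 + q.2))
    (hg.comp (measurable_fst.add measurable_snd))

end ExponentialConvolution

/-! ### Poisson points above a linear boundary -/

section FirstPassage

open scoped ENNReal

/-- The volume of `{0 < t₁ < ⋯ < tₖ < x : tᵢ ≥ i * a}`, for `x ≥ k * a`. -/
noncomputable def ballotVolume (a : ℝ) : ℕ → ℝ → ℝ
  | 0, _ => 1
  | k + 1, x => x ^ k * (x - (k + 1) * a) / (k + 1).factorial

/-- The density of the `(k + 1)`-st point `x` of a Poisson process of rate `μ`, on the event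
that its `i`-th point is at least `i * a` for all `i ≤ k`. -/
noncomputable def ballotDensity (a μ : ℝ) (k : ℕ) (x : ℝ) : ℝ :=
  μ ^ (k + 1) * Real.exp (-(μ * x)) * ballotVolume a k x

variable {a μ : ℝ}

lemma continuous_ballotVolume (k : ℕ) : Continuous (ballotVolume a k) := by
  cases k with
  | zero => exact continuous_const
  | succ k => unfold ballotVolume; fun_prop

lemma continuous_ballotDensity (k : ℕ) : Continuous (ballotDensity a μ k) := by
  have := continuous_ballotVolume (a := a) k
  unfold ballotDensity; fun_prop

lemma ballotVolume_nonneg (ha : 0 < a) (k : ℕ) {x : ℝ} (hx : k * a ≤ x) :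
    0 ≤ ballotVolume a k x := by
  cases k with
  | zero => exact zero_le_one
  | succ k =>
    push_cast at hx
    have : 0 ≤ x := le_trans (by positivity) hx
    have h2 : 0 ≤ x - (k + 1) * a := by linarith
    rw [ballotVolume]; positivity

lemma ballotDensity_nonneg (ha : 0 < a) (hμ : 0 < μ) (k : ℕ) {x : ℝ} (hx : k * a ≤ x) :
    0 ≤ ballotDensity a μ k x := by
  have := ballotVolume_nonneg ha k hx
  rw [ballotDensity]; positivity

/-- Integration over the last point. With the zero of `ballotVolume a (k + 1)` at `(k + 1) * a`,
this recursion determines the volumes. -/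
lemma hasDerivAt_ballotVolume (k : ℕ) (x : ℝ) :
    HasDerivAt (ballotVolume a (k + 1)) (ballotVolume a k x) x := by
  cases k with
  | zero =>
    have : ballotVolume a 1 = fun x => x - a := by funext x; simp [ballotVolume]
    rw [zero_add, this]
    exact (hasDerivAt_id x).sub_const a
  | succ k =>
    have h := (((hasDerivAt_pow (k + 1) x).mul ((hasDerivAt_id x).sub_const
      (((k + 1 : ℕ) + 1 : ℝ) * a))).div_const ((k + 1 + 1).factorial : ℝ))
    refine h.congr_deriv ?_
    have h1 : ((k + 1 + 1).factorial : ℝ) = (k + 1 + 1) * (k + 1).factorial := by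
      rw [Nat.factorial_succ]; push_cast; ring
    have h2 : ((k + 1).factorial : ℝ) ≠ 0 := by positivity
    have h3 : ((k : ℝ) + 1 + 1) ≠ 0 := by positivity
    simp only [ballotVolume, id, h1]
    field_simp
    push_cast
    ring_nf

/-- The exponentials multiply to `exp (-(μ * y))`, free of `x`, so only the volume is integrated,
and its antiderivative vanishes at `(k + 1) * a`. -/
lemma lintegral_ballotDensity_mul_exp (ha : 0 < a) (hμ : 0 < μ) (k : ℕ) {y : ℝ}
    (hy : (k + 1) * a ≤ y) :
    ∫⁻ x in Icc ((k + 1) * a) y,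
      ENNReal.ofReal (ballotDensity a μ k x) * ENNReal.ofReal (μ * Real.exp (-(μ * (y - x)))) =
      ENNReal.ofReal (ballotDensity a μ (k + 1) y) := by
  have hka : ∀ x ∈ Icc ((k + 1) * a) y, k * a ≤ x := fun x hx => by linarith [hx.1]
  have h1 : ∀ x ∈ Icc ((k + 1) * a) y,
      ENNReal.ofReal (ballotDensity a μ k x) * ENNReal.ofReal (μ * Real.exp (-(μ * (y - x)))) =
      ENNReal.ofReal (μ ^ (k + 2) * Real.exp (-(μ * y)) * ballotVolume a k x) := by
    intro x hx
    rw [← ENNReal.ofReal_mul (ballotDensity_nonneg ha hμ k (hka x hx)), ballotDensity]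
    congr 1
    have : Real.exp (-(μ * y)) = Real.exp (-(μ * x)) * Real.exp (-(μ * (y - x))) := by
      rw [← Real.exp_add]; congr 1; ring
    rw [this]; ring
  rw [setLIntegral_congr_fun measurableSet_Icc h1, lintegral_Icc_of_hasDerivAt
    (H := fun x => μ ^ (k + 2) * Real.exp (-(μ * y)) * ballotVolume a (k + 1) x) hy]
  · have : ballotVolume a (k + 1) ((k + 1) * a) = 0 := by simp [ballotVolume]
    rw [this, mul_zero, sub_zero, ballotDensity]
  · exact fun x _ => (hasDerivAt_ballotVolume k x).const_mul _
  · exact ((continuous_ballotVolume k).const_mul _).continuousOn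
  · intro x hx
    have := ballotVolume_nonneg ha k (hka x hx)
    positivity

variable {Ω : Type*} {mΩ : MeasurableSpace Ω} {P : Measure Ω} [IsProbabilityMeasure P]

/-- The event that the partial sums `t 0, t 1, …` stay above `0, a, 2 * a, …`, as far as these
constraints concern `t 0, …, t (k - 1)`, and `0 ≤ t 0`. -/
def staysAbove (a : ℝ) (t : ℕ → Ω → ℝ) (k : ℕ) : Set Ω :=
  {ω | 0 ≤ t 0 ω} ∩ {ω | ∀ i < k, (i + 1) * a ≤ t i ω}

omit [IsProbabilityMeasure P] mΩ in
lemma staysAbove_succ (t : ℕ → Ω → ℝ) (k : ℕ) :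
    staysAbove a t (k + 1) = staysAbove a t k ∩ t k ⁻¹' Ici ((k + 1) * a) := by
  ext ω
  simp only [staysAbove, mem_inter_iff, mem_ofPred_eq, mem_preimage, mem_Ici]
  constructor
  · rintro ⟨h1, h2⟩
    exact ⟨⟨h1, fun i hi => h2 i (by omega)⟩, h2 k (by omega)⟩
  · rintro ⟨⟨h1, h2⟩, h3⟩
    refine ⟨h1, fun i hi => ?_⟩
    rcases Nat.lt_succ_iff_lt_or_eq.1 hi with hi | rfl
    · exact h2 i hi
    · exact h3

/-- With `Y` the age of the current service, memorylessness gives `-Y + U j` the density `exp (-(μ *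
Y))` times the exponential one on `[0, ∞)`; each later service convolves once more. The past enters
only through a factor independent of `k` and `g`, which makes the conditional law universal. -/
theorem lintegral_staysAbove (ha : 0 < a) (hμ : 0 < μ) (𝓕 : Filtration ℕ mΩ) {U : ℕ → Ω → ℝ}
    (hU : ∀ n, Measurable[𝓕 (n + 1)] (U n))
    (hind : ∀ n, Indep (𝓕 n) (MeasurableSpace.comap (U n) inferInstance) P)
    (hlaw : ∀ n, P.map (U n) = expMeasure μ) {j : ℕ} {Z : Ω → ℝ≥0∞} (hZ : Measurable[𝓕 j] Z)
    {Y : Ω → ℝ} (hY : Measurable[𝓕 j] Y) (hZY : ∀ ω, Z ω ≠ 0 → 0 ≤ Y ω) (k : ℕ)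
    {g : ℝ → ℝ≥0∞} (hg : Measurable g) {t : ℕ → Ω → ℝ} (ht0 : t 0 = fun ω => -Y ω + U j ω)
    (htsucc : ∀ i, t (i + 1) = fun ω => t i ω + U (j + i + 1) ω) :
    ∫⁻ ω, Z ω * (staysAbove a t k).indicator 1 ω * g (t k ω) ∂P =
      (∫⁻ ω, Z ω * ENNReal.ofReal (Real.exp (-(μ * Y ω))) ∂P) *
        ∫⁻ x in Ici (k * a), ENNReal.ofReal (ballotDensity a μ k x) * g x := by
  have htm : ∀ i, Measurable[𝓕 (j + i + 1)] (t i) := by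
    intro i
    induction i with
    | zero =>
      rw [ht0]
      exact (hY.neg.mono (𝓕.mono (by omega)) le_rfl).add (hU j)
    | succ i ih =>
      rw [htsucc]
      exact (ih.mono (𝓕.mono (by omega)) le_rfl).add (hU _)
  induction k generalizing g with
  | zero =>
    have h1 : ∀ ω, Z ω * (staysAbove a t 0).indicator 1 ω * g (t 0 ω) =
        Z ω * (Ici 0).indicator g (-Y ω + U j ω) := by
      intro ω
      rw [mul_assoc]
      congr 1
      by_cases h : 0 ≤ t 0 ω
      · rw [indicator_of_mem (by exact ⟨h, fun i hi => by omega⟩), ← congrFun ht0 ω,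
          indicator_of_mem (mem_Ici.2 h), Pi.one_apply, one_mul]
      · rw [indicator_of_notMem (fun h' => h h'.1), ← congrFun ht0 ω,
          indicator_of_notMem (by simpa using h), zero_mul]
    have hgi : Measurable ((Ici (0 : ℝ)).indicator g) := hg.indicator measurableSet_Ici
    rw [lintegral_congr h1, lintegral_mul_comp_of_indep (𝓕.le j) ((hU j).mono (𝓕.le _) le_rfl)
      (hind j) hZ hY (g := fun y u => (Ici 0).indicator g (-y + u))
      (hgi.comp (measurable_fst.neg.add measurable_snd)), hlaw,
      ← lintegral_mul_const _ (by
        exact (hZ.mono (𝓕.le _) le_rfl).mul (by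
          have := hY.mono (𝓕.le _) le_rfl
          fun_prop))]
    refine lintegral_congr fun ω => ?_
    by_cases hZ0 : Z ω = 0
    · simp [hZ0]
    rw [mul_assoc]
    congr 1
    have hy := hZY ω hZ0
    rw [lintegral_add_expMeasure μ _ hgi, ← lintegral_const_mul _ (by
      have := (continuous_ballotDensity (a := a) (μ := μ) 0).measurable
      fun_prop), ← lintegral_indicator measurableSet_Ici, ← lintegral_indicator measurableSet_Ici]
    refine lintegral_congr fun x => ?_
    by_cases hx : 0 ≤ x
    · rw [indicator_of_mem (by rw [mem_Ici]; linarith),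
        indicator_of_mem (mem_Ici.2 hx), indicator_of_mem (by simpa using hx), ← mul_assoc,
        ← ENNReal.ofReal_mul (Real.exp_pos _).le]
      congr 2
      simp only [ballotDensity, ballotVolume]
      have : Real.exp (-(μ * (x - -Y ω))) = Real.exp (-(μ * Y ω)) * Real.exp (-(μ * x)) := by
        rw [← Real.exp_add]; congr 1; ring
      rw [this]; ring
    · rw [indicator_of_notMem (s := Ici (((0 : ℕ) : ℝ) * a)) (by simpa using hx)]
      refine indicator_apply_eq_zero.2 fun _ => ?_
      rw [indicator_of_notMem (by simpa using hx), mul_zero]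
  | succ k ih =>
    have hset : MeasurableSet[𝓕 (j + k + 1)] (staysAbove a t (k + 1)) := by
      have h0 : MeasurableSet[𝓕 (j + k + 1)] (t 0 ⁻¹' Ici 0) :=
        ((htm 0).mono (𝓕.mono (by omega)) le_rfl) measurableSet_Ici
      have : staysAbove a t (k + 1) = t 0 ⁻¹' Ici 0 ∩
          ⋂ i ∈ Iio (k + 1), t i ⁻¹' Ici ((i + 1) * a) := by
        ext ω; simp [staysAbove]
      rw [this]
      refine MeasurableSet.inter h0 (MeasurableSet.biInter (to_countable _) fun i hi => ?_)
      rw [mem_Iio] at hi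
      exact ((htm i).mono (𝓕.mono (by omega)) le_rfl) measurableSet_Ici
    have hZ' : Measurable[𝓕 (j + k + 1)]
        fun ω => Z ω * (staysAbove a t (k + 1)).indicator 1 ω :=
      (hZ.mono (𝓕.mono (by omega)) le_rfl).mul (measurable_const.indicator hset)
    have h1 := lintegral_mul_comp_of_indep (𝓕.le (j + k + 1))
      ((hU (j + k + 1)).mono (𝓕.le _) le_rfl) (hind _) hZ' (htm k)
      (g := fun y u => g (y + u)) (hg.comp (measurable_fst.add measurable_snd))
    simp only [htsucc k]
    rw [h1, hlaw]
    have : SFinite (expMeasure μ) := by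
      have := isProbabilityMeasure_expMeasure hμ
      infer_instance
    have hG := measurable_lintegral_add (expMeasure μ) hg
    -- The last constraint `t k ≥ (k + 1) * a` moves into the test function, so that the induction
    -- hypothesis, with one constraint fewer, applies.
    have h2 : ∀ ω, Z ω * (staysAbove a t (k + 1)).indicator 1 ω *
        ∫⁻ u, g (t k ω + u) ∂expMeasure μ = Z ω * (staysAbove a t k).indicator 1 ω *
        (Ici ((k + 1) * a)).indicator (fun y => ∫⁻ u, g (y + u) ∂expMeasure μ) (t k ω) := by
      intro ω
      rw [mul_assoc, mul_assoc]
      congr 1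
      by_cases h : (k + 1) * a ≤ t k ω
      · rw [indicator_of_mem (mem_Ici.2 h)]
        congr 1
        have hiff : ω ∈ staysAbove a t (k + 1) ↔ ω ∈ staysAbove a t k := by
          rw [staysAbove_succ]
          exact ⟨fun h' => h'.1, fun h' => ⟨h', h⟩⟩
        by_cases hω : ω ∈ staysAbove a t k
        · rw [indicator_of_mem hω, indicator_of_mem (hiff.2 hω)]
        · rw [indicator_of_notMem hω, indicator_of_notMem (fun h' => hω (hiff.1 h'))]
      · have hω : ω ∉ staysAbove a t (k + 1) := by
          rw [staysAbove_succ]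
          exact fun h' => h h'.2
        rw [indicator_of_notMem hω, indicator_of_notMem (s := Ici _) (by simpa using h), zero_mul,
          mul_zero]
    rw [lintegral_congr h2, ih (hG.indicator measurableSet_Ici)]
    congr 1
    have hq := (continuous_ballotDensity (a := a) (μ := μ) k).measurable.ennreal_ofReal
    have h3 : ∫⁻ x in Ici (k * a), ENNReal.ofReal (ballotDensity a μ k x) *
        (Ici ((k + 1) * a)).indicator (fun y => ∫⁻ u, g (y + u) ∂expMeasure μ) x =
        ∫⁻ x in Ici ((k + 1) * a), ENNReal.ofReal (ballotDensity a μ k x) *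
          ∫⁻ u, g (x + u) ∂expMeasure μ := by
      rw [← lintegral_indicator measurableSet_Ici, ← lintegral_indicator measurableSet_Ici]
      refine lintegral_congr fun x => ?_
      by_cases hx : (k + 1) * a ≤ x
      · rw [indicator_of_mem (mem_Ici.2 (by linarith)), indicator_of_mem (mem_Ici.2 hx),
          indicator_of_mem (mem_Ici.2 hx)]
      · rw [indicator_of_notMem (s := Ici ((k + 1) * a)) (by simpa using hx)]
        refine indicator_apply_eq_zero.2 fun _ => ?_
        rw [indicator_of_notMem (by simpa using hx), mul_zero]
    rw [h3, lintegral_mul_lintegral_add_expMeasure μ _ hq hg]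
    push_cast
    refine setLIntegral_congr_fun measurableSet_Ici fun y hy => ?_
    rw [lintegral_ballotDensity_mul_exp ha hμ k hy]

end FirstPassage

/-! ### The probability of finding the server occupied -/

section Occupied

open scoped ENNReal

/-- The probability that the server is occupied at the arrival of the `n`-th next client, if at
the present arrival it is to become free after a time `v`. -/
noncomputable def occupiedProb (a μ : ℝ) : ℕ → ℝ → ℝ≥0∞
  | 0 => (Ici 0).indicator 1
  | n + 1 => fun v => ∫⁻ u, occupiedProb a μ n (max v 0 - a + u) ∂expMeasure μ

variable {a μ : ℝ}

lemma sFinite_expMeasure (hμ : 0 < μ) : SFinite (expMeasure μ) := by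
  have := isProbabilityMeasure_expMeasure hμ
  infer_instance

lemma measurable_occupiedProb (hμ : 0 < μ) (n : ℕ) : Measurable (occupiedProb a μ n) := by
  have := sFinite_expMeasure hμ
  induction n with
  | zero => exact measurable_one.indicator measurableSet_Ici
  | succ n ih =>
    exact (measurable_lintegral_add (expMeasure μ) ih).comp
      ((measurable_id.max measurable_const).sub_const a)

lemma occupiedProb_le_one (hμ : 0 < μ) (n : ℕ) (v : ℝ) : occupiedProb a μ n v ≤ 1 := by
  have := isProbabilityMeasure_expMeasure hμ
  induction n generalizing v with
  | zero => exact indicator_le_self _ _ _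
  | succ n ih => exact (lintegral_mono fun u => ih _).trans (by simp)

lemma occupiedProb_mono (n : ℕ) : Monotone (occupiedProb a μ n) := by
  induction n with
  | zero =>
    intro v w h
    by_cases hv : 0 ≤ v
    · rw [occupiedProb, indicator_of_mem (mem_Ici.2 hv), indicator_of_mem (mem_Ici.2 (hv.trans h))]
      rfl
    · rw [occupiedProb, indicator_of_notMem (by simpa using hv)]
      exact zero_le
  | succ n ih =>
    intro v w h
    refine lintegral_mono fun u => ih ?_
    have := max_le_max_right 0 h
    linarith

lemma lintegral_exp_expMeasure {θ : ℝ} (hθ : θ < μ) (hμ : 0 < μ) (x : ℝ) :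
    ∫⁻ u, ENNReal.ofReal (Real.exp (θ * (x + u))) ∂expMeasure μ =
      ENNReal.ofReal (μ / (μ - θ) * Real.exp (θ * x)) := by
  have h0 : 0 < μ - θ := sub_pos.2 hθ
  have := isProbabilityMeasure_expMeasure h0
  have h1 : ∫⁻ _, 1 ∂expMeasure (μ - θ) = 1 := by simp
  rw [lintegral_expMeasure _ _ measurable_const] at h1
  rw [lintegral_expMeasure μ _ (by fun_prop), ← mul_one (ENNReal.ofReal (μ / (μ - θ) * _)), ← h1,
    ← lintegral_const_mul _ (by fun_prop)]
  refine lintegral_congr fun u => ?_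
  rw [mul_one, ← ENNReal.ofReal_mul (by positivity), ← ENNReal.ofReal_mul (by positivity)]
  congr 1
  have : Real.exp (-((μ - θ) * u)) = Real.exp (-(μ * u)) * Real.exp (θ * u) := by
    rw [← Real.exp_add]; congr 1; ring
  rw [this, mul_add, Real.exp_add]
  field_simp

/-- Coupling with common services: because of `max v 0`, two starts merge once the upper one is at
most 0 at an arrival. That this has not happened in `n` steps is bounded by an exponential moment.
-/
lemma occupiedProb_le_add {θ : ℝ} (hθ0 : 0 < θ) (hθ : θ < μ) (n : ℕ) {v w : ℝ} (hwv : w ≤ v) :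
    occupiedProb a μ n v ≤ occupiedProb a μ n w +
      ENNReal.ofReal ((μ / (μ - θ) * Real.exp (-(θ * a))) ^ n * Real.exp (θ * v)) := by
  have hμ : 0 < μ := hθ0.trans hθ
  have h0 : 0 < μ - θ := sub_pos.2 hθ
  induction n generalizing v w with
  | zero =>
    by_cases hv : 0 ≤ v
    · refine le_trans (occupiedProb_le_one hμ 0 v) (le_add_left ?_)
      rw [pow_zero, one_mul, ENNReal.one_le_ofReal, Real.one_le_exp_iff]
      positivity
    · rw [occupiedProb, indicator_of_notMem (by simpa using hv)]
      exact zero_le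
  | succ n ih =>
    by_cases hv : 0 ≤ v
    · have hm : max w 0 ≤ v := max_le hwv hv
      have hmeas := measurable_occupiedProb (a := a) hμ n
      calc occupiedProb a μ (n + 1) v
          ≤ ∫⁻ u, (occupiedProb a μ n (max w 0 - a + u) +
            ENNReal.ofReal ((μ / (μ - θ) * Real.exp (-(θ * a))) ^ n) *
              ENNReal.ofReal (Real.exp (θ * ((v - a) + u)))) ∂expMeasure μ := by
            refine lintegral_mono fun u => ?_
            rw [max_eq_left hv, ← ENNReal.ofReal_mul (by positivity)]
            exact ih (by linarith)
        _ = _ := by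
            rw [lintegral_add_left (by fun_prop), lintegral_const_mul _ (by fun_prop),
              lintegral_exp_expMeasure hθ hμ, ← ENNReal.ofReal_mul (by positivity)]
            congr 2
            have : Real.exp (θ * (v - a)) = Real.exp (-(θ * a)) * Real.exp (θ * v) := by
              rw [← Real.exp_add]; congr 1; ring
            rw [this]; ring
    · rw [not_le] at hv
      have : occupiedProb a μ (n + 1) v = occupiedProb a μ (n + 1) w := by
        simp only [occupiedProb, max_eq_right hv.le, max_eq_right (hwv.trans hv.le)]
      rw [this]
      exact le_self_add

/-- Memorylessness: beyond `a` the exponential law restarts with weight `exp (-(a * θ))`. -/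
lemma lintegral_indicator_comp_sub_expMeasure {θ : ℝ} (ha : 0 ≤ a) {h : ℝ → ℝ≥0∞}
    (hh : Measurable h) :
    ∫⁻ q, (Ici a).indicator (fun q => h (q - a)) q ∂expMeasure θ =
      ENNReal.ofReal (Real.exp (-(a * θ))) * ∫⁻ x, h x ∂expMeasure θ := by
  have hh' : Measurable fun q => h (q - a) := hh.comp (measurable_id.sub_const a)
  rw [lintegral_expMeasure θ _ (hh'.indicator measurableSet_Ici),
    lintegral_expMeasure θ _ hh, ← lintegral_const_mul _ (by fun_prop),
    ← lintegral_Ici_comp_sub a (f := fun x => ENNReal.ofReal (Real.exp (-(a * θ))) *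
      (ENNReal.ofReal (θ * Real.exp (-(θ * x))) * h x)), ← lintegral_indicator measurableSet_Ici,
    ← lintegral_indicator measurableSet_Ici]
  refine lintegral_congr fun q => ?_
  by_cases hq : a ≤ q
  · rw [indicator_of_mem (mem_Ici.2 (ha.trans hq)), indicator_of_mem (mem_Ici.2 hq),
      indicator_of_mem (mem_Ici.2 hq), ← mul_assoc, ← ENNReal.ofReal_mul (Real.exp_pos _).le]
    congr 2
    have : Real.exp (-(θ * q)) = Real.exp (-(a * θ)) * Real.exp (-(θ * (q - a))) := by
      rw [← Real.exp_add]; congr 1; ring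
    rw [this]; ring
  · rw [indicator_of_notMem (s := Ici a) (a := q) (by simpa using hq)]
    refine indicator_apply_eq_zero.2 fun _ => ?_
    rw [indicator_of_notMem (by simpa using hq), mul_zero]

lemma expMeasure_Ici {θ : ℝ} (hθ : 0 < θ) (ha : 0 ≤ a) :
    expMeasure θ (Ici a) = ENNReal.ofReal (Real.exp (-(a * θ))) := by
  have := isProbabilityMeasure_expMeasure hθ
  have h := lintegral_indicator_comp_sub_expMeasure (θ := θ) ha (h := 1) measurable_one
  simpa [lintegral_indicator measurableSet_Ici] using h

variable {ζ : ℝ}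

/-- The law `Exp (μ * (1 - ζ))` of the sojourn time in the queue with the FIFO policy is
invariant under Lindley's recursion. -/
lemma lintegral_lindley_expMeasure (ha : 0 < a) (hμ : 0 < μ) (hζ0 : 0 < ζ) (hζ1 : ζ < 1)
    (hζ : ζ = Real.exp (-(a * (μ * (1 - ζ))))) {g : ℝ → ℝ≥0∞} (hg : Measurable g) :
    ∫⁻ q, ∫⁻ u, g (max (q - a) 0 + u) ∂expMeasure μ ∂expMeasure (μ * (1 - ζ)) =
      ∫⁻ y, g y ∂expMeasure (μ * (1 - ζ)) := by
  have hθ : 0 < μ * (1 - ζ) := mul_pos hμ (sub_pos.2 hζ1)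
  have hprob := isProbabilityMeasure_expMeasure hθ
  have := sFinite_expMeasure hμ
  have hG := measurable_lintegral_add (expMeasure μ) hg
  -- If `q < a` the server is idle on arrival; if `a ≤ q`, then `q - a` has the old law again. The
  -- root equation enters only by giving these cases the weights `1 - ζ` and `ζ`.
  have hsplit : ∀ q, ∫⁻ u, g (max (q - a) 0 + u) ∂expMeasure μ =
      (Ici a)ᶜ.indicator (fun _ => ∫⁻ u, g (0 + u) ∂expMeasure μ) q +
      (Ici a).indicator (fun q => ∫⁻ u, g (q - a + u) ∂expMeasure μ) q := by
    intro q
    by_cases hq : a ≤ q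
    · rw [indicator_of_mem (mem_Ici.2 hq), indicator_of_notMem (by simpa using hq), zero_add,
        max_eq_left (sub_nonneg.2 hq)]
    · rw [indicator_of_notMem (s := Ici a) (by simpa using hq),
        indicator_of_mem (by simpa using hq), add_zero,
        max_eq_right (sub_nonpos.2 (not_le.1 hq).le)]
  have hcompl : expMeasure (μ * (1 - ζ)) (Ici a)ᶜ = ENNReal.ofReal (1 - ζ) := by
    rw [prob_compl_eq_one_sub measurableSet_Ici, expMeasure_Ici hθ ha.le, ← hζ,
      ENNReal.ofReal_sub _ hζ0.le, ENNReal.ofReal_one]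
  -- The density of a sum of independent `Exp (μ * (1 - ζ))` and `Exp μ` variables; its negative
  -- part cancels against the idle case.
  have hinner : ∀ y ∈ Ici (0 : ℝ), ∫⁻ x in Icc 0 y,
      ENNReal.ofReal (μ * (1 - ζ) * Real.exp (-(μ * (1 - ζ) * x))) *
        ENNReal.ofReal (μ * Real.exp (-(μ * (y - x)))) =
      ENNReal.ofReal (μ * (1 - ζ) / ζ *
        (Real.exp (-(μ * (1 - ζ) * y)) - Real.exp (-(μ * y)))) := by
    intro y hy
    have h1 : ∀ x ∈ Icc 0 y, ENNReal.ofReal (μ * (1 - ζ) * Real.exp (-(μ * (1 - ζ) * x))) *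
        ENNReal.ofReal (μ * Real.exp (-(μ * (y - x)))) =
        ENNReal.ofReal (μ * (1 - ζ) * μ * Real.exp (-(μ * y) + μ * ζ * x)) := by
      intro x _
      rw [← ENNReal.ofReal_mul (by positivity)]
      congr 1
      have : Real.exp (-(μ * y) + μ * ζ * x) =
          Real.exp (-(μ * (1 - ζ) * x)) * Real.exp (-(μ * (y - x))) := by
        rw [← Real.exp_add]; congr 1; ring
      rw [this]; ring
    rw [setLIntegral_congr_fun measurableSet_Icc h1, lintegral_Icc_of_hasDerivAt
      (H := fun x => μ * (1 - ζ) / ζ * Real.exp (-(μ * y) + μ * ζ * x)) hy]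
    · have : -(μ * y) + μ * ζ * y = -(μ * (1 - ζ) * y) := by ring
      rw [this, mul_zero, add_zero, ← mul_sub]
    · intro x _
      have h := ((((hasDerivAt_id x).const_mul (μ * ζ)).const_add (-(μ * y))).exp).const_mul
        (μ * (1 - ζ) / ζ)
      refine h.congr_deriv ?_
      simp only [id, mul_one]
      field_simp
    · fun_prop
    · intro x _; positivity
  simp_rw [hsplit]
  rw [lintegral_add_left (measurable_const.indicator measurableSet_Ici.compl),
    lintegral_indicator_comp_sub_expMeasure ha.le hG, ← hζ,
    lintegral_indicator measurableSet_Ici.compl, lintegral_const, Measure.restrict_apply_univ,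
    hcompl, lintegral_expMeasure _ _ hG,
    lintegral_mul_lintegral_add_expMeasure μ 0 (by fun_prop) hg,
    lintegral_add_expMeasure μ 0 hg, lintegral_expMeasure _ _ hg]
  have hm1 : Measurable fun y => ENNReal.ofReal (μ * (1 - ζ) / ζ *
        (Real.exp (-(μ * (1 - ζ) * y)) - Real.exp (-(μ * y)))) * g y := by fun_prop
  have hm2 : Measurable fun y => ENNReal.ofReal (μ * Real.exp (-(μ * (y - 0)))) * g y := by
    fun_prop
  have hcongr : ∫⁻ y in Ici 0, (∫⁻ x in Icc 0 y,
      ENNReal.ofReal (μ * (1 - ζ) * Real.exp (-(μ * (1 - ζ) * x))) *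
        ENNReal.ofReal (μ * Real.exp (-(μ * (y - x))))) * g y =
      ∫⁻ y in Ici 0, ENNReal.ofReal (μ * (1 - ζ) / ζ *
        (Real.exp (-(μ * (1 - ζ) * y)) - Real.exp (-(μ * y)))) * g y :=
    setLIntegral_congr_fun measurableSet_Ici fun y hy => by rw [hinner y hy]
  rw [hcongr, ← lintegral_const_mul _ hm1, mul_comm, ← lintegral_const_mul _ hm2,
    ← lintegral_add_left (hm2.const_mul _)]
  refine setLIntegral_congr_fun measurableSet_Ici fun y hy => ?_
  have hdiff : 0 ≤ Real.exp (-(μ * (1 - ζ) * y)) - Real.exp (-(μ * y)) := by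
    rw [sub_nonneg, Real.exp_le_exp]
    have : 0 ≤ μ * ζ * y := mul_nonneg (by positivity) hy
    linarith
  have h1ζ : 0 < 1 - ζ := sub_pos.2 hζ1
  rw [← mul_assoc, ← mul_assoc, ← add_mul, ← ENNReal.ofReal_mul h1ζ.le,
    ← ENNReal.ofReal_mul hζ0.le, ← ENNReal.ofReal_add (by positivity) (by positivity)]
  congr 2
  rw [sub_zero]
  field_simp
  ring

lemma lintegral_occupiedProb_expMeasure (ha : 0 < a) (hμ : 0 < μ) (hζ0 : 0 < ζ) (hζ1 : ζ < 1)
    (hζ : ζ = Real.exp (-(a * (μ * (1 - ζ))))) (n : ℕ) :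
    ∫⁻ q, occupiedProb a μ n (q - a) ∂expMeasure (μ * (1 - ζ)) = ENNReal.ofReal ζ := by
  have hθ : 0 < μ * (1 - ζ) := mul_pos hμ (sub_pos.2 hζ1)
  induction n with
  | zero =>
    have : ∀ q, occupiedProb a μ 0 (q - a) = (Ici a).indicator 1 q := by
      intro q; simp [occupiedProb, indicator]
    simp_rw [this]
    rw [lintegral_indicator_one measurableSet_Ici, expMeasure_Ici hθ ha.le, ← hζ]
  | succ n ih =>
    have hg : Measurable fun q => occupiedProb a μ n (q - a) :=
      (measurable_occupiedProb hμ n).comp (measurable_id.sub_const a)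
    rw [← ih, ← lintegral_lindley_expMeasure ha hμ hζ0 hζ1 hζ hg]
    refine lintegral_congr fun q => lintegral_congr fun u => ?_
    congr 1; ring

theorem tendsto_occupiedProb (ha : 0 < a) (hμ : 0 < μ) (hstable : 1 < a * μ) (hζ0 : 0 < ζ)
    (hζ1 : ζ < 1) (hζ : ζ = Real.exp (-(a * (μ * (1 - ζ))))) (v : ℝ) :
    Tendsto (fun n => occupiedProb a μ n v) atTop (𝓝 (ENNReal.ofReal ζ)) := by
  obtain ⟨θ, hθ0, hθ, hρ⟩ : ∃ θ, 0 < θ ∧ θ < μ ∧ μ / (μ - θ) * Real.exp (-(θ * a)) < 1 := by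
    -- This `θ` minimizes `μ / (μ - θ) * exp (-(θ * a))`; the minimum `a * μ * exp (1 - a * μ)` is
    -- below 1 because `a * μ > 1`.
    refine ⟨μ - 1 / a, ?_, ?_, ?_⟩
    · rw [sub_pos, div_lt_iff₀ ha, mul_comm]; exact hstable
    · have : 0 < 1 / a := by positivity
      linarith
    · have h1 : μ / (μ - (μ - 1 / a)) = a * μ := by field_simp; ring
      have h2 : (μ - 1 / a) * a = a * μ - 1 := by field_simp
      rw [h1, h2, Real.exp_neg, ← div_eq_mul_inv, div_lt_one (Real.exp_pos _)]
      have := Real.add_one_lt_exp (x := a * μ - 1) (by linarith)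
      linarith
  have h0 : 0 < μ - θ := sub_pos.2 hθ
  set ρ := μ / (μ - θ) * Real.exp (-(θ * a)) with hρdef
  have hρ0 : 0 < ρ := by positivity
  have hprob := isProbabilityMeasure_expMeasure (mul_pos hμ (sub_pos.2 hζ1))
  -- The coupling error between the start `v` and the stationary start `q - a`; the truncation at 1
  -- supplies the dominating function.
  let ε : ℕ → ℝ → ℝ≥0∞ := fun n q =>
    min 1 (ENNReal.ofReal (ρ ^ n * Real.exp (θ * max v (q - a))))
  have hε : ∀ n, Measurable (ε n) := fun n => by fun_prop
  have hle : ∀ n q x y, max x y = max v (q - a) →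
      occupiedProb a μ n x ≤ occupiedProb a μ n y + ε n q := by
    intro n q x y hxy
    rcases le_total x y with h | h
    · exact (occupiedProb_mono n h).trans le_self_add
    · rw [max_eq_left h] at hxy
      rw [← min_add_add_left, le_min_iff]
      exact ⟨(occupiedProb_le_one hμ n x).trans (le_add_left le_rfl),
        hxy ▸ occupiedProb_le_add hθ0 hθ n h⟩
  have hlim : Tendsto (fun n => ∫⁻ q, ε n q ∂expMeasure (μ * (1 - ζ))) atTop (𝓝 0) := by
    have h1 : (0 : ℝ≥0∞) = ∫⁻ q, 0 ∂expMeasure (μ * (1 - ζ)) := by simp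
    rw [h1]
    refine tendsto_lintegral_of_dominated_convergence 1 hε
      (fun n => Eventually.of_forall fun q => min_le_left _ _) (by simp)
      (Eventually.of_forall fun q => ?_)
    have h2 : Tendsto (fun n => ENNReal.ofReal (ρ ^ n * Real.exp (θ * max v (q - a)))) atTop
        (𝓝 0) := by
      have := (tendsto_pow_atTop_nhds_zero_of_lt_one hρ0.le hρ).mul_const
        (Real.exp (θ * max v (q - a)))
      rw [zero_mul] at this
      simpa using ENNReal.tendsto_ofReal this
    exact tendsto_of_tendsto_of_tendsto_of_le_of_le tendsto_const_nhds h2 (fun _ => zero_le)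
      (fun _ => min_le_right _ _)
  have hup : ∀ n, occupiedProb a μ n v ≤
      ENNReal.ofReal ζ + ∫⁻ q, ε n q ∂expMeasure (μ * (1 - ζ)) := by
    intro n
    rw [← lintegral_occupiedProb_expMeasure ha hμ hζ0 hζ1 hζ n, ← lintegral_add_right _ (hε n)]
    calc occupiedProb a μ n v = ∫⁻ q, occupiedProb a μ n v ∂expMeasure (μ * (1 - ζ)) := by simp
      _ ≤ _ := lintegral_mono fun q => hle n q _ _ rfl
  have hdown : ∀ n, ENNReal.ofReal ζ ≤
      occupiedProb a μ n v + ∫⁻ q, ε n q ∂expMeasure (μ * (1 - ζ)) := by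
    intro n
    rw [← lintegral_occupiedProb_expMeasure ha hμ hζ0 hζ1 hζ n]
    calc _ ≤ ∫⁻ q, (occupiedProb a μ n v + ε n q) ∂expMeasure (μ * (1 - ζ)) :=
          lintegral_mono fun q => hle n q _ _ (max_comm _ _)
      _ = _ := by rw [lintegral_add_right _ (hε n)]; simp
  refine tendsto_of_tendsto_of_tendsto_of_le_of_le (g := fun n => ENNReal.ofReal ζ -
    ∫⁻ q, ε n q ∂expMeasure (μ * (1 - ζ))) (h := fun n => ENNReal.ofReal ζ +
    ∫⁻ q, ε n q ∂expMeasure (μ * (1 - ζ))) ?_ ?_ (fun n => tsub_le_iff_right.2 (hdown n)) hup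
  · simpa using ENNReal.Tendsto.sub (tendsto_const_nhds (x := ENNReal.ofReal ζ)) hlim
      (Or.inl ENNReal.ofReal_ne_top)
  · simpa using (tendsto_const_nhds (x := ENNReal.ofReal ζ)).add hlim

variable {Ω : Type*} {mΩ : MeasurableSpace Ω} {P : Measure Ω} [IsProbabilityMeasure P]

open LIFOQueue

omit [IsProbabilityMeasure P] in
lemma lintegral_eq_tsum_fiber {M : Ω → ℕ} (hM : Measurable M) {f : Ω → ℝ≥0∞} (hf : Measurable f) :
    ∫⁻ ω, f ω ∂P = ∑' m, ∫⁻ ω, (M ⁻¹' {m}).indicator 1 ω * f ω ∂P := by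
  have hm : ∀ m, MeasurableSet (M ⁻¹' {m}) := fun m => hM (measurableSet_singleton m)
  have hmf : ∀ m, AEMeasurable (fun ω => (M ⁻¹' {m}).indicator 1 ω * f ω) P := fun m =>
    ((measurable_one.indicator (hm m)).mul hf).aemeasurable
  rw [← lintegral_tsum hmf]
  refine lintegral_congr fun ω => ?_
  rw [tsum_eq_single (M ω)]
  · simp
  · intro m hm
    rw [indicator_of_notMem (by simpa using hm.symm), zero_mul]

omit [IsProbabilityMeasure P] in
lemma measurable_freeTime (𝓕 : Filtration ℕ mΩ) {U : ℕ → Ω → ℝ} {M : Ω → ℕ} {R : Ω → ℝ}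
    (hU : ∀ n, Measurable[𝓕 (n + 1)] (U n)) (hM : Measurable[𝓕 0] M) (hR : Measurable[𝓕 0] R)
    (j : ℕ) : Measurable[𝓕 j] fun ω => freeTime a (M ω) (R ω) (fun i => U i ω) j := by
  induction j with
  | zero => exact hR
  | succ j ih =>
    have h1 : Measurable[𝓕 (j + 1)] fun ω => (((j : ℝ) - (M ω : ℝ)) * a) :=
      (Measurable.of_discrete (f := fun m : ℕ => (((j : ℝ) - (m : ℝ)) * a))).comp
        (hM.mono (𝓕.mono (Nat.zero_le _)) le_rfl)
    exact ((ih.mono (𝓕.mono (Nat.le_succ j)) le_rfl).max h1).add (hU j)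

/-- Markov property, one service at a time. On `{M = m}` the index `n + M` is deterministic, and
there `freeTime (n + m) - n * a` follows Lindley's recursion. -/
lemma lintegral_occupiedProb_freeTime (hμ : 0 < μ) (𝓕 : Filtration ℕ mΩ) {U : ℕ → Ω → ℝ}
    {M : Ω → ℕ} {R : Ω → ℝ} (hU : ∀ n, Measurable[𝓕 (n + 1)] (U n))
    (hind : ∀ n, Indep (𝓕 n) (MeasurableSpace.comap (U n) inferInstance) P)
    (hlaw : ∀ n, P.map (U n) = expMeasure μ) (hM : Measurable[𝓕 0] M) (hR : Measurable[𝓕 0] R)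
    (m n i : ℕ) :
    ∫⁻ ω, (M ⁻¹' {m}).indicator 1 ω *
        occupiedProb a μ i (freeTime a (M ω) (R ω) (fun i => U i ω) (n + m) - n * a) ∂P =
      ∫⁻ ω, (M ⁻¹' {m}).indicator 1 ω *
        occupiedProb a μ (n + i) (freeTime a (M ω) (R ω) (fun i => U i ω) m) ∂P := by
  induction n generalizing i with
  | zero => simp
  | succ n ih =>
    rw [show n + 1 + i = n + (i + 1) by ring, ← ih (i + 1)]
    have hD : Measurable[𝓕 (n + m)] ((M ⁻¹' {m}).indicator (1 : Ω → ℝ≥0∞)) :=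
      (measurable_const (a := (1 : ℝ≥0∞))).indicator
        ((hM.mono (𝓕.mono (Nat.zero_le _)) le_rfl) (measurableSet_singleton m))
    have hF := measurable_freeTime (a := a) 𝓕 hU hM hR (n + m)
    have hV : Measurable[𝓕 (n + m)]
        fun ω => max (freeTime a (M ω) (R ω) (fun i => U i ω) (n + m) - n * a) 0 - a :=
      ((hF.sub_const _).max measurable_const).sub_const a
    have h := lintegral_mul_comp_of_indep (𝓕.le (n + m)) ((hU (n + m)).mono (𝓕.le _) le_rfl)
      (hind _) hD hV (g := fun y u => occupiedProb a μ i (y + u))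
      ((measurable_occupiedProb hμ i).comp (measurable_fst.add measurable_snd))
    rw [hlaw] at h
    refine Eq.trans (lintegral_congr fun ω => ?_) h
    by_cases hω : M ω = m
    · congr 2
      rw [show n + 1 + m = (n + m) + 1 by ring, freeTime, hω,
        show (((n + m : ℕ) : ℝ) - m) * a = n * a by push_cast; ring]
      have hmax : ∀ x y : ℝ, max x y = max (x - y) 0 + y := fun x y => by
        rw [← max_add_add_right, sub_add_cancel, zero_add]
      rw [hmax]
      push_cast
      ring
    · rw [indicator_of_notMem (by simpa using hω), zero_mul, zero_mul]

theorem tendsto_measure_occupied (ha : 0 < a) (hμ : 0 < μ) (hstable : 1 < a * μ) (hζ0 : 0 < ζ)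
    (hζ1 : ζ < 1) (hζ : ζ = Real.exp (-(a * (μ * (1 - ζ))))) (𝓕 : Filtration ℕ mΩ)
    {U : ℕ → Ω → ℝ}
    {M : Ω → ℕ} {R : Ω → ℝ} (hU : ∀ n, Measurable[𝓕 (n + 1)] (U n))
    (hind : ∀ n, Indep (𝓕 n) (MeasurableSpace.comap (U n) inferInstance) P)
    (hlaw : ∀ n, P.map (U n) = expMeasure μ) (hM : Measurable[𝓕 0] M)
    (hR : Measurable[𝓕 0] R) :
    Tendsto (fun n : ℕ => P {ω | n * a ≤ freeTime a (M ω) (R ω) (fun i => U i ω) (n + M ω)}) atTop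
      (𝓝 (ENNReal.ofReal ζ)) := by
  have hM' : Measurable M := hM.mono (𝓕.le 0) le_rfl
  have hF : ∀ n, Measurable fun ω => freeTime a (M ω) (R ω) (fun i => U i ω) (n + M ω) := by
    intro n
    have h1 : Measurable fun q : ℕ × Ω =>
        freeTime a (M q.2) (R q.2) (fun i => U i q.2) (n + q.1) :=
      measurable_from_prod_countable_right fun j =>
        (measurable_freeTime 𝓕 hU hM hR (n + j)).mono (𝓕.le _) le_rfl
    exact h1.comp (hM'.prodMk measurable_id)
  have hocc := fun n => measurable_occupiedProb (a := a) hμ n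
  -- Lindley's recursion starts at service `M ω`, the one FIFO would give to client 0. Its random
  -- starting value is finite, so pointwise convergence and domination by 1 suffice afterwards.
  have hmain : ∀ n : ℕ, P {ω | n * a ≤ freeTime a (M ω) (R ω) (fun i => U i ω) (n + M ω)} =
      ∫⁻ ω, occupiedProb a μ n (freeTime a (M ω) (R ω) (fun i => U i ω) (M ω)) ∂P := by
    intro n
    have h0 : MeasurableSet {ω | n * a ≤ freeTime a (M ω) (R ω) (fun i => U i ω) (n + M ω)} :=
      measurableSet_le measurable_const (hF n)
    have hF0 := hF 0
    simp only [zero_add] at hF0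
    rw [← lintegral_indicator_one h0, lintegral_eq_tsum_fiber hM' (measurable_one.indicator h0),
      lintegral_eq_tsum_fiber hM' (f := fun ω => occupiedProb a μ n
        (freeTime a (M ω) (R ω) (fun i => U i ω) (M ω))) ((hocc n).comp hF0)]
    refine tsum_congr fun m => ?_
    have h := lintegral_occupiedProb_freeTime (a := a) hμ 𝓕 hU hind hlaw hM hR m n 0
    rw [add_zero] at h
    have hcongr : ∀ k : ℕ, ∀ φ : ℝ → ℝ≥0∞,
        ∫⁻ ω, (M ⁻¹' {m}).indicator 1 ω *
          φ (freeTime a (M ω) (R ω) (fun i => U i ω) (k + M ω)) ∂P =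
        ∫⁻ ω, (M ⁻¹' {m}).indicator 1 ω *
          φ (freeTime a (M ω) (R ω) (fun i => U i ω) (k + m)) ∂P := by
      intro k φ
      refine lintegral_congr fun ω => ?_
      by_cases hω : M ω = m
      · rw [hω]
      · rw [indicator_of_notMem (by simpa using hω), zero_mul, zero_mul]
    have h2 := hcongr 0 (occupiedProb a μ n)
    simp only [zero_add] at h2
    rw [h2, ← h, ← hcongr n fun x => occupiedProb a μ 0 (x - n * a)]
    refine lintegral_congr fun ω => ?_
    congr 1
    simp [occupiedProb, indicator]
  simp_rw [hmain]
  have hc : ENNReal.ofReal ζ = ∫⁻ _, ENNReal.ofReal ζ ∂P := by simp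
  rw [hc]
  have hF0 := hF 0
  simp only [zero_add] at hF0
  exact tendsto_lintegral_of_dominated_convergence 1 (fun n => (hocc n).comp hF0)
    (fun n => Eventually.of_forall fun ω => occupiedProb_le_one hμ n _) (by simp)
    (Eventually.of_forall fun ω => tendsto_occupiedProb ha hμ hstable hζ0 hζ1 hζ _)

end Occupied

/-! ### Busy periods and the passage that ends a wait -/

namespace LIFOQueue

variable {a : ℝ} {m : ℕ} {r : ℝ} {u : ℕ → ℝ} {s : ℤ → ℝ}

lemma freeTime_mono (hu : ∀ i, 0 ≤ u i) : Monotone (freeTime a m r u) :=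
  monotone_nat_of_le_succ fun j => by
    rw [freeTime]
    exact (le_max_left _ _).trans (le_add_of_nonneg_right (hu j))

/-- The time from the arrival of client `n` to the end of the service `j + i`, if the server is
never idle from the beginning of the `j`-th service on. -/
noncomputable def busyTime (a : ℝ) (m : ℕ) (r : ℝ) (u : ℕ → ℝ) (n j : ℕ) : ℕ → ℝ
  | 0 => -(n * a - max (freeTime a m r u j) (((j : ℝ) - m) * a)) + u j
  | i + 1 => busyTime a m r u n j i + u (j + i + 1)

/-- While the lower bounds hold the server is never idle: by `j + 1 ≤ n + m`, the maximum in
`freeTime` is its first argument. -/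
lemma busyTime_eq (ha : 0 < a) {n j k : ℕ} (hj : j < n + m)
    (hk : ∀ i < k, ((i : ℝ) + 1) * a ≤ busyTime a m r u n j i) {i : ℕ} (hi : i ≤ k) :
    busyTime a m r u n j i = freeTime a m r u (j + 1 + i) - n * a := by
  induction i with
  | zero => rw [busyTime, add_zero, freeTime]; ring
  | succ i ih =>
    have ih := ih (by omega)
    have h1 := hk i (by omega)
    have hle : (((j + 1 + i : ℕ) : ℝ) - m) * a ≤ freeTime a m r u (j + 1 + i) := by
      have h2 : ((j + 1 + i : ℕ) : ℝ) - m ≤ n + (i + 1) := by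
        have : ((j + 1 : ℕ) : ℝ) ≤ ((n + m : ℕ) : ℝ) := by exact_mod_cast hj
        push_cast at this ⊢
        linarith
      have h3 := mul_le_mul_of_nonneg_right h2 ha.le
      linarith
    rw [busyTime, ih, ← add_assoc (j + 1) i 1, freeTime, max_eq_left hle,
      show j + i + 1 = j + 1 + i by ring]
    ring

/-- A stable queue does not stay busy forever. -/
lemma exists_freeTime_lt (ha : 0 < a) {c : ℝ} (hc : c < a)
    (hu : Tendsto (fun N : ℕ => (∑ i ∈ Finset.range N, u i) / N) atTop (𝓝 c)) {n J : ℕ}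
    (hJ : J ≤ n + m) : ∃ i : ℕ, freeTime a m r u (J + i) < ((n : ℝ) + i + 1) * a := by
  by_contra! hcon
  -- Without idleness `freeTime` grows by plain sums of services. Their averages would eventually be
  -- at least `a - C / N`, against the limit `c < a`.
  have hsum : ∀ i, freeTime a m r u (J + i) =
      freeTime a m r u J + ∑ l ∈ Finset.range (J + i), u l - ∑ l ∈ Finset.range J, u l := by
    intro i
    induction i with
    | zero => simp
    | succ i ih =>
      have hle : (((J + i : ℕ) : ℝ) - m) * a ≤ freeTime a m r u (J + i) := by
        refine le_trans (mul_le_mul_of_nonneg_right ?_ ha.le) (hcon i)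
        have : (J : ℝ) ≤ ((n + m : ℕ) : ℝ) := by exact_mod_cast hJ
        push_cast at this ⊢
        linarith
      rw [← add_assoc, freeTime, max_eq_left hle, ih, Finset.sum_range_succ]
      ring
  set C := freeTime a m r u J - ∑ l ∈ Finset.range J, u l + J * a with hC
  have hlow : ∀ᶠ N : ℕ in atTop, a - C / N ≤ (∑ i ∈ Finset.range N, u i) / N := by
    filter_upwards [eventually_ge_atTop (J + 1)] with N hN
    have hN0 : (0 : ℝ) < N := by exact_mod_cast (by omega : 0 < N)
    obtain ⟨i, rfl⟩ := Nat.exists_eq_add_of_le (by omega : J ≤ N)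
    have h1 := hcon i
    rw [hsum] at h1
    rw [le_div_iff₀ hN0, sub_mul, div_mul_cancel₀ _ hN0.ne']
    have h2 : 0 ≤ ((n : ℝ) + 1) * a := by positivity
    push_cast
    linarith
  have hlim : Tendsto (fun N : ℕ => a - C / N) atTop (𝓝 (a - 0)) :=
    tendsto_const_nhds.sub (tendsto_const_div_atTop_nhds_zero_nat C)
  have := le_of_tendsto_of_tendsto hlim hu hlow
  linarith

/-- The server is occupied by the `j`-th service at the arrival of client `n`, and `k` is the
first index such that less than `k + 1` clients have arrived after `n` by the end of the
service `j + k`. -/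
def IsPassage (a : ℝ) (m : ℕ) (r : ℝ) (u : ℕ → ℝ) (n j k : ℕ) : Prop :=
  (freeTime a m r u j < n * a ∧ j < n + m) ∧
    (0 ≤ busyTime a m r u n j 0 ∧ ∀ i < k, ((i : ℝ) + 1) * a ≤ busyTime a m r u n j i) ∧
    busyTime a m r u n j k < ((k : ℝ) + 1) * a

lemma busyTime_zero_nonneg_iff {n j : ℕ} :
    0 ≤ busyTime a m r u n j 0 ↔ n * a ≤ freeTime a m r u (j + 1) := by
  rw [busyTime, freeTime]
  constructor <;> intro h <;> linarith

lemma occupied_of_busyTime_nonneg (hu : ∀ i, 0 ≤ u i) {n j : ℕ}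
    (h : freeTime a m r u j < n * a ∧ j < n + m) (h0 : 0 ≤ busyTime a m r u n j 0) :
    r < n * a ∧ n * a ≤ freeTime a m r u (n + m) :=
  ⟨(freeTime_mono hu (Nat.zero_le j)).trans_lt h.1,
    (busyTime_zero_nonneg_iff.1 h0).trans (freeTime_mono hu h.2)⟩

lemma eq_of_busyTime_nonneg (hu : ∀ i, 0 ≤ u i) {n j j' : ℕ}
    (h : freeTime a m r u j < n * a) (h0 : 0 ≤ busyTime a m r u n j 0)
    (h' : freeTime a m r u j' < n * a) (h0' : 0 ≤ busyTime a m r u n j' 0) : j = j' := by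
  rw [busyTime_zero_nonneg_iff] at h0 h0'
  rcases lt_trichotomy j j' with hlt | heq | hlt
  · exact absurd (h0.trans (freeTime_mono hu hlt)) (not_le.2 h')
  · exact heq
  · exact absurd (h0'.trans (freeTime_mono hu hlt)) (not_le.2 h)

/-- The first index with `n * a ≤ freeTime` is not 0, because the initial residual service ends
before `n * a`; `j` is its predecessor. -/
lemma exists_busyTime_nonneg {n : ℕ} (hr : r < n * a)
    (h : n * a ≤ freeTime a m r u (n + m)) :
    ∃ j, (freeTime a m r u j < n * a ∧ j < n + m) ∧ 0 ≤ busyTime a m r u n j 0 := by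
  classical
  have hex : ∃ j, n * a ≤ freeTime a m r u j := ⟨_, h⟩
  have hle : Nat.find hex ≤ n + m := Nat.find_min' hex h
  have hspec := Nat.find_spec hex
  have hpos : Nat.find hex ≠ 0 := fun h0 => by
    rw [h0] at hspec; exact absurd hspec (not_le.2 hr)
  obtain ⟨j, hj⟩ := Nat.exists_eq_succ_of_ne_zero hpos
  refine ⟨j, ⟨not_le.1 (Nat.find_min hex (by omega)), by omega⟩, ?_⟩
  rw [busyTime_zero_nonneg_iff]
  rwa [hj] at hspec

lemma exists_isPassage (ha : 0 < a) {c : ℝ} (hc : c < a)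
    (hu : Tendsto (fun N : ℕ => (∑ i ∈ Finset.range N, u i) / N) atTop (𝓝 c)) {n : ℕ}
    (hr : r < n * a) (h : n * a ≤ freeTime a m r u (n + m)) :
    ∃ j k, IsPassage a m r u n j k := by
  classical
  obtain ⟨j, hj, h0⟩ := exists_busyTime_nonneg hr h
  have hex : ∃ k, busyTime a m r u n j k < ((k : ℝ) + 1) * a := by
    by_contra! hcon
    obtain ⟨i, hi⟩ := exists_freeTime_lt (r := r) ha hc hu (show j + 1 ≤ n + m from hj.2)
    have h1 := busyTime_eq (k := i) ha hj.2 (fun l _ => hcon l) le_rfl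
    have h2 := hcon i
    linarith
  exact ⟨j, Nat.find hex, hj, ⟨h0, fun i hi => not_lt.1 (Nat.find_min hex hi)⟩,
    Nat.find_spec hex⟩

lemma IsPassage.unique (hu : ∀ i, 0 ≤ u i) {n j k j' k' : ℕ} (h : IsPassage a m r u n j k)
    (h' : IsPassage a m r u n j' k') : j = j' ∧ k = k' := by
  obtain rfl := eq_of_busyTime_nonneg hu h.1.1 h.2.1.1 h'.1.1 h'.2.1.1
  refine ⟨rfl, ?_⟩
  rcases lt_trichotomy k k' with hlt | heq | hlt
  · exact absurd (h'.2.1.2 k hlt) (not_le.2 h.2.2)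
  · exact heq
  · exact absurd (h.2.1.2 k' hlt) (not_le.2 h'.2.2)

/-- The service in progress at the arrival of `n` is the `j`-th, so the first free epoch from then
on has index `j + 1`, and `k` counts from there. -/
lemma IsPassage.wait_eq (ha : 0 < a) (hs : ∀ i, 0 ≤ s i) (hr : 0 ≤ r) {n j k : ℕ}
    (h : IsPassage a m r (serviceLength a m r s) n j k) :
    wait a m r s n = busyTime a m r (serviceLength a m r s) n j k := by
  have hF := free_eq_freeTime (m := m) ha hs hr
  have ht : ∀ i ≤ k, _ := fun i hi => busyTime_eq (i := i) ha h.1.2 h.2.1.2 hi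
  obtain ⟨hcl, hst⟩ := client_of_le_free (m := m) (n := n) (J := j + 1) (i := k) ha hs hr
    h.1.2
    (fun l hl => (free_mono hs (Nat.lt_succ_iff.1 hl)).trans_lt (by simpa only [hF] using h.1.1))
    (by rw [hF]; exact busyTime_zero_nonneg_iff.1 h.2.1.1)
    (fun l hl => by
      have h1 := h.2.1.2 l hl
      rw [ht l hl.le] at h1
      rw [hF]; linarith)
    (by
      have h1 := h.2.2
      rw [ht k le_rfl] at h1
      rw [hF]; linarith)
  rw [wait_eq_of_client_eq ha hs hr hcl, hst, hF, ht k le_rfl]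

lemma exists_client_eq (ha : 0 < a) (hs : ∀ i, 0 ≤ s i) (hr : 0 ≤ r) {c : ℝ} (hc : c < a)
    (hu : Tendsto (fun N : ℕ => (∑ i ∈ Finset.range N, serviceLength a m r s i) / N) atTop (𝓝 c))
    (n : ℕ) : ∃ j, client a m r s j = n := by
  classical
  have hF := free_eq_freeTime (m := m) ha hs hr
  by_cases h : (state a m r s (n + m)).free < n * a
  · exact ⟨_, (client_of_free_lt ha hs hr h).1⟩
  rw [not_lt] at h
  have hex : ∃ j, n * a ≤ (state a m r s j).free := ⟨_, h⟩
  have hJ : Nat.find hex ≤ n + m := Nat.find_min' hex h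
  have hex' := exists_freeTime_lt (r := r) ha hc hu hJ
  refine ⟨_, (client_of_le_free (i := Nat.find hex') ha hs hr hJ
    (fun l hl => not_le.1 (Nat.find_min hex hl)) (Nat.find_spec hex) (fun l hl => ?_) ?_).1⟩
  · rw [hF]; exact not_lt.1 (Nat.find_min hex' hl)
  · rw [hF]; exact Nat.find_spec hex'

lemma wait_eq_zero (ha : 0 < a) (hs : ∀ i, 0 ≤ s i) (hr : 0 ≤ r) {n : ℕ}
    (h : freeTime a m r (serviceLength a m r s) (n + m) < n * a) : wait a m r s n = 0 := by
  rw [← free_eq_freeTime ha hs hr] at h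
  obtain ⟨hcl, hst⟩ := client_of_free_lt ha hs hr h
  rw [wait_eq_of_client_eq ha hs hr hcl, hst, sub_self]

end LIFOQueue

/-! ### The root of the equation for ζ -/

section Root

lemma existsUnique_root {c : ℝ} (hc : 1 < c) :
    ∃ ζ : ℝ, (0 < ζ ∧ ζ < 1 ∧ ζ = Real.exp (-c * (1 - ζ))) ∧
      ∀ z : ℝ, 0 < z → z < 1 → z = Real.exp (-c * (1 - z)) → z = ζ := by
  have hc0 : 0 < c := by linarith
  -- The number 1 also solves the equation. Two roots below it would be three points of a strictly
  -- convex graph on one line.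
  have huniq : ∀ x y : ℝ, x < y → y < 1 → x = Real.exp (-c * (1 - x)) →
      y = Real.exp (-c * (1 - y)) → False := by
    intro x y hxy hy hx0 hy0
    have h1x : 0 < 1 - x := by linarith
    have hp : 0 < (1 - y) / (1 - x) := div_pos (by linarith) h1x
    have hq : 0 < (y - x) / (1 - x) := div_pos (by linarith) h1x
    have hne : -c * (1 - x) ≠ 0 := mul_ne_zero (neg_ne_zero.2 hc0.ne') h1x.ne'
    have h := strictConvexOn_exp.2 (mem_univ (-c * (1 - x))) (mem_univ (0 : ℝ)) hne hp hq
      (by field_simp; ring)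
    have h2 : ((1 - y) / (1 - x)) • (-c * (1 - x)) + ((y - x) / (1 - x)) • (0 : ℝ) =
        -c * (1 - y) := by
      simp only [smul_eq_mul]; field_simp; ring
    rw [h2, ← hy0, ← hx0, Real.exp_zero, smul_eq_mul, smul_eq_mul] at h
    have h3 : (1 - y) / (1 - x) * x + (y - x) / (1 - x) * 1 = y := by field_simp; ring
    linarith
  let g : ℝ → ℝ := fun z => Real.exp (-c * (1 - z)) - z
  have hgc : Continuous g := by fun_prop
  have hg0 : 0 < g 0 := by simp only [g, sub_zero]; positivity
  -- At `1 / c` the claim is `c ≤ exp (c - 1)`; stopping there keeps the root below 1.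
  have hg1 : g (1 / c) ≤ 0 := by
    have h1 : -c * (1 - 1 / c) = -(c - 1) := by field_simp
    have h2 := Real.add_one_le_exp (c - 1)
    simp only [g]
    rw [h1, Real.exp_neg, sub_nonpos, one_div]
    exact inv_anti₀ hc0 (by linarith)
  have hlt : 1 / c < 1 := by rwa [div_lt_one hc0]
  obtain ⟨ζ, hζ, hζ0⟩ := intermediate_value_Icc' (by positivity : (0 : ℝ) ≤ 1 / c)
    hgc.continuousOn ⟨hg1, hg0.le⟩
  have hroot : ζ = Real.exp (-c * (1 - ζ)) := (sub_eq_zero.1 hζ0).symm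
  have hζ1 : ζ < 1 := hζ.2.trans_lt hlt
  refine ⟨ζ, ⟨hroot ▸ Real.exp_pos _, hζ1, hroot⟩, fun z _ hz1 hz => ?_⟩
  rcases lt_trichotomy z ζ with h | h | h
  · exact (huniq z ζ h hζ1 hz hroot).elim
  · exact h
  · exact (huniq ζ z h hz1 hroot hz).elim

end Root

/-! ### The equilibrium density -/

section WaitDensity

open scoped ENNReal

/-- The density of the equilibrium waiting time on `(0, ∞)`. -/
noncomputable def waitDensity (a μ ζ x : ℝ) : ℝ :=
  if x ≤ 0 then 0 else ζ * ballotDensity a μ ⌊x / a⌋₊ x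

variable {a μ ζ : ℝ}

lemma measurable_waitDensity : Measurable (waitDensity a μ ζ) := by
  have h1 : Measurable fun q : ℕ × ℝ => ballotDensity a μ q.1 q.2 :=
    measurable_from_prod_countable_right fun k => (continuous_ballotDensity k).measurable
  have h2 : Measurable fun x : ℝ => (⌊x / a⌋₊, x) :=
    (Nat.measurable_floor.comp (measurable_id.div_const a)).prodMk measurable_id
  exact Measurable.ite measurableSet_Iic measurable_const ((h1.comp h2).const_mul ζ)

lemma waitDensity_of_mem_Ico (ha : 0 < a) {k : ℕ} {x : ℝ} (hx0 : 0 < x)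
    (hx : x ∈ Ico (k * a) ((k + 1) * a)) : waitDensity a μ ζ x = ζ * ballotDensity a μ k x := by
  have : ⌊x / a⌋₊ = k := by
    rw [Nat.floor_eq_iff (by positivity), le_div_iff₀ ha, div_lt_iff₀ ha]
    exact hx
  rw [waitDensity, if_neg (not_le.2 hx0), this]

lemma waitDensity_of_mem_Ioo (ha : 0 < a) {k : ℕ} {x : ℝ} (hx : x ∈ Ioo (k * a) ((k + 1) * a)) :
    waitDensity a μ ζ x = μ ^ (k + 1) * ζ * x ^ ((k : ℤ) - 1) * (x - k * a) * Real.exp (-μ * x)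
      / (Nat.factorial k : ℝ) := by
  have hx0 : 0 < x := lt_of_le_of_lt (by positivity) hx.1
  rw [waitDensity_of_mem_Ico ha hx0 ⟨hx.1.le, hx.2⟩, ballotDensity, neg_mul]
  cases k with
  | zero =>
    simp only [ballotVolume, Nat.factorial_zero, Nat.cast_zero, Nat.cast_one, zero_sub, zero_mul,
      sub_zero, zpow_neg_one, zero_add, pow_one, mul_one, div_one]
    field_simp
  | succ k =>
    rw [show ((k + 1 : ℕ) : ℤ) - 1 = k by push_cast; ring, zpow_natCast, ballotVolume]
    push_cast
    ring

lemma tendsto_waitDensity (ha : 0 < a) {k : ℕ} (hk : 1 ≤ k) :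
    Tendsto (waitDensity a μ ζ) (𝓝[>] (k * a)) (𝓝 0) := by
  obtain ⟨k, rfl⟩ := Nat.exists_eq_succ_of_ne_zero (by omega : k ≠ 0)
  have hlt : ((k + 1 : ℕ) : ℝ) * a < ((k + 1 : ℕ) + 1) * a := by nlinarith
  have h0 : ζ * ballotDensity a μ (k + 1) ((k + 1 : ℕ) * a) = 0 := by
    simp [ballotDensity, ballotVolume]
  have hcont : Continuous fun x => ζ * ballotDensity a μ (k + 1) x :=
    continuous_const.mul (continuous_ballotDensity (k + 1))
  have h : Tendsto (fun x => ζ * ballotDensity a μ (k + 1) x) (𝓝[>] (((k + 1 : ℕ) : ℝ) * a))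
      (𝓝 0) := (hcont.tendsto' _ 0 h0).mono_left nhdsWithin_le_nhds
  refine h.congr' ?_
  filter_upwards [Ioo_mem_nhdsGT hlt] with x hx
  exact (waitDensity_of_mem_Ico ha (lt_of_le_of_lt (by positivity) hx.1) ⟨hx.1.le, hx.2⟩).symm

lemma lintegral_waitDensity (ha : 0 < a) (hζ : 0 < ζ) {B : Set ℝ}
    (hB : MeasurableSet B) :
    ∫⁻ x in B, ENNReal.ofReal (waitDensity a μ ζ x) =
      ENNReal.ofReal ζ * ∑' k : ℕ, ∫⁻ x in Ici (k * a), ENNReal.ofReal (ballotDensity a μ k x) *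
        (Iio (((k : ℝ) + 1) * a) ∩ B).indicator 1 x := by
  have hm : ∀ k : ℕ, Measurable fun x => (Ici (k * a)).indicator (fun x =>
      ENNReal.ofReal (ballotDensity a μ k x) * (Iio (((k : ℝ) + 1) * a) ∩ B).indicator 1 x) x :=
    fun k => ((continuous_ballotDensity k).measurable.ennreal_ofReal.mul
      (measurable_one.indicator (measurableSet_Iio.inter hB))).indicator measurableSet_Ici
  simp_rw [← lintegral_indicator measurableSet_Ici]
  rw [← lintegral_indicator hB, ← lintegral_tsum fun k => (hm k).aemeasurable,
    ← lintegral_const_mul _ (Measurable.tsum hm)]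
  -- At `x = 0` the term `k = 0` need not vanish although `waitDensity` does, so this null point is
  -- discarded.
  have hne : ∀ᵐ x : ℝ, x ≠ 0 := by simp [ae_iff]
  refine lintegral_congr_ae ?_
  filter_upwards [hne] with x hx0
  rcases lt_or_gt_of_ne hx0 with hx | hx
  · have h1 : ∀ k : ℕ, x ∉ Ici ((k : ℝ) * a) := fun k h =>
      absurd (le_trans (by positivity) (mem_Ici.1 h)) (not_le.2 hx)
    simp [h1, waitDensity, hx.le, indicator]
  · have hk : x ∈ Ico ((⌊x / a⌋₊ : ℝ) * a) ((⌊x / a⌋₊ + 1) * a) := by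
      have h0 : 0 ≤ x / a := by positivity
      exact ⟨(le_div_iff₀ ha).1 (Nat.floor_le h0), (div_lt_iff₀ ha).1 (Nat.lt_floor_add_one _)⟩
    rw [tsum_eq_single ⌊x / a⌋₊]
    · rw [indicator_of_mem (mem_Ici.2 hk.1)]
      by_cases hxB : x ∈ B
      · rw [indicator_of_mem hxB, indicator_of_mem (by exact ⟨hk.2, hxB⟩), Pi.one_apply, mul_one,
          waitDensity_of_mem_Ico ha hx hk, ENNReal.ofReal_mul hζ.le]
      · rw [indicator_of_notMem hxB, indicator_of_notMem (fun h => hxB h.2), mul_zero, mul_zero]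
    · intro k hne
      refine indicator_apply_eq_zero.2 fun hxk => ?_
      rw [indicator_of_notMem, mul_zero]
      intro h
      refine hne ?_
      have h0 : 0 ≤ x / a := by positivity
      rw [eq_comm, Nat.floor_eq_iff h0, le_div_iff₀ ha, div_lt_iff₀ ha]
      exact ⟨hxk, h.1⟩

lemma lintegral_ballotDensity_zero (hμ : 0 < μ) :
    ∫⁻ x in Ici (((0 : ℕ) : ℝ) * a), ENNReal.ofReal (ballotDensity a μ 0 x) * 1 = 1 := by
  have := isProbabilityMeasure_expMeasure hμ
  have h : ∫⁻ _, 1 ∂expMeasure μ = 1 := by simp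
  rw [lintegral_expMeasure _ _ measurable_const] at h
  simpa [ballotDensity, ballotVolume] using h

end WaitDensity

/-! ### The exponential mean and the law of large numbers -/

section Exponential

variable {μ : ℝ}

lemma expMeasure_ae_nonneg (hμ : 0 < μ) : ∀ᵐ x ∂expMeasure μ, 0 ≤ x := by
  have := isProbabilityMeasure_expMeasure hμ
  have h := expMeasure_Ici hμ le_rfl
  rw [zero_mul, neg_zero, Real.exp_zero, ENNReal.ofReal_one] at h
  exact (prob_compl_eq_zero_iff measurableSet_Ici).2 h

lemma lintegral_ofReal_expMeasure (hμ : 0 < μ) :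
    ∫⁻ x, ENNReal.ofReal x ∂expMeasure μ = ENNReal.ofReal (1 / μ) := by
  rw [lintegral_expMeasure _ _ (by fun_prop), setLIntegral_congr Ioi_ae_eq_Ici.symm]
  have h := Real.integral_rpow_mul_exp_neg_mul_Ioi (a := 2) (r := μ) two_pos hμ
  have hG : Real.Gamma 2 = 1 := by
    rw [← one_add_one_eq_two, Real.Gamma_add_one one_ne_zero, Real.Gamma_one, mul_one]
  -- A non-integrable function would have Bochner integral 0, whereas the Gamma integral is
  -- positive.
  have hint : IntegrableOn (fun t : ℝ => t ^ ((2 : ℝ) - 1) * Real.exp (-(μ * t))) (Ioi 0) := by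
    by_contra hcon
    rw [integral_undef hcon, hG] at h
    have : (0 : ℝ) < (1 / μ) ^ (2 : ℝ) * 1 := by positivity
    linarith
  have h1 : ∀ x ∈ Ioi (0 : ℝ), ENNReal.ofReal (μ * Real.exp (-(μ * x))) * ENNReal.ofReal x =
      ENNReal.ofReal (μ * (x ^ ((2 : ℝ) - 1) * Real.exp (-(μ * x)))) := by
    intro x _
    rw [← ENNReal.ofReal_mul (by positivity)]
    congr 1
    rw [show (2 : ℝ) - 1 = 1 by norm_num, Real.rpow_one]
    ring
  rw [setLIntegral_congr_fun measurableSet_Ioi h1, ← ofReal_integral_eq_lintegral_ofReal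
    (hint.const_mul μ), integral_const_mul, h, hG]
  · congr 1
    rw [Real.rpow_two]
    field_simp
  · refine (ae_restrict_iff' measurableSet_Ioi).2 (Eventually.of_forall fun x hx => ?_)
    have : (0 : ℝ) < x := hx
    simp only [Pi.zero_apply]
    positivity

lemma integrable_id_expMeasure (hμ : 0 < μ) : Integrable (fun x => x) (expMeasure μ) := by
  refine ⟨by fun_prop, ?_⟩
  rw [hasFiniteIntegral_iff_ofReal (expMeasure_ae_nonneg hμ), lintegral_ofReal_expMeasure hμ]
  exact ENNReal.ofReal_lt_top

lemma integral_id_expMeasure (hμ : 0 < μ) : ∫ x, x ∂expMeasure μ = 1 / μ := by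
  rw [integral_eq_lintegral_of_nonneg_ae (expMeasure_ae_nonneg hμ) (by fun_prop),
    lintegral_ofReal_expMeasure hμ, ENNReal.toReal_ofReal (by positivity)]

variable {Ω : Type*} {mΩ : MeasurableSpace Ω} {P : Measure Ω}

/-- The strong law needs only pairwise independence, which holds since `U i` is `𝓕 j`-measurable for
`i < j`. -/
lemma ae_tendsto_average (hμ : 0 < μ) (𝓕 : Filtration ℕ mΩ) {U : ℕ → Ω → ℝ}
    (hU : ∀ n, Measurable[𝓕 (n + 1)] (U n))
    (hind : ∀ n, Indep (𝓕 n) (MeasurableSpace.comap (U n) inferInstance) P)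
    (hlaw : ∀ n, P.map (U n) = expMeasure μ) :
    ∀ᵐ ω ∂P, Tendsto (fun N : ℕ => (∑ i ∈ Finset.range N, U i ω) / N) atTop (𝓝 (1 / μ)) := by
  have hUm : ∀ n, Measurable (U n) := fun n => (hU n).mono (𝓕.le _) le_rfl
  have hlt : ∀ i j, i < j → IndepFun (U i) (U j) P := by
    intro i j hij
    rw [IndepFun_iff_Indep]
    exact indep_of_indep_of_le_left (hind j)
      (measurable_iff_comap_le.1 ((hU i).mono (𝓕.mono hij) le_rfl))
  have hint : Integrable (U 0) P := by
    have h := integrable_id_expMeasure hμ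
    rw [← hlaw 0] at h
    exact h.comp_measurable (hUm 0)
  have hmean : ∫ ω, U 0 ω ∂P = 1 / μ := by
    rw [← integral_id_expMeasure hμ, ← hlaw 0, integral_map (hUm 0).aemeasurable (by fun_prop)]
  rw [← hmean]
  refine strong_law_ae_real U hint (fun i j hij => ?_) fun i =>
    ⟨(hUm i).aemeasurable, (hUm 0).aemeasurable, by rw [hlaw, hlaw]⟩
  rcases lt_or_gt_of_ne hij with h | h
  · exact hlt i j h
  · exact (hlt j i h).symm

end Exponential

/-! ### The law of the wait of a client who finds the server occupied -/

section Law

open scoped ENNReal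
open LIFOQueue

variable {a μ : ℝ} {Ω : Type*} {mΩ : MeasurableSpace Ω} {P : Measure Ω} [IsProbabilityMeasure P]

/-- Given that the server is occupied at the arrival of client `n` by a service begun earlier,
the waiting time has a law that does not depend on `n` nor on the initial state. -/
theorem measure_wait_inter_occupied (ha : 0 < a) (hμ : 0 < μ) (hstable : 1 < a * μ)
    (𝓕 : Filtration ℕ mΩ) {U : ℕ → Ω → ℝ} {M : Ω → ℕ} {R : Ω → ℝ} {S : ℤ → Ω → ℝ}
    (hUeq : ∀ n ω, U n ω = serviceLength a (M ω) (R ω) (fun i => S i ω) n)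
    (hU : ∀ n, Measurable[𝓕 (n + 1)] (U n))
    (hind : ∀ n, Indep (𝓕 n) (MeasurableSpace.comap (U n) inferInstance) P)
    (hlaw : ∀ n, P.map (U n) = expMeasure μ) (hM : Measurable[𝓕 0] M) (hR : Measurable[𝓕 0] R)
    (hR0 : ∀ ω, 0 ≤ R ω) (hS0 : ∀ᵐ ω ∂P, ∀ i, 0 ≤ S i ω) (n : ℕ) {B : Set ℝ}
    (hB : MeasurableSet B) (hW : Measurable fun ω => wait a (M ω) (R ω) (fun i => S i ω) n) :
    P ({ω | R ω < n * a ∧ n * a ≤ freeTime a (M ω) (R ω) (fun i => U i ω) (n + M ω)} ∩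
        (fun ω => wait a (M ω) (R ω) (fun i => S i ω) n) ⁻¹' B) =
      P {ω | R ω < n * a ∧ n * a ≤ freeTime a (M ω) (R ω) (fun i => U i ω) (n + M ω)} *
        ∑' k : ℕ, ∫⁻ x in Ici (k * a), ENNReal.ofReal (ballotDensity a μ k x) *
          (Iio (((k : ℝ) + 1) * a) ∩ B).indicator 1 x := by
  have hUm : ∀ n, Measurable (U n) := fun n => (hU n).mono (𝓕.le _) le_rfl
  have hM' : Measurable M := hM.mono (𝓕.le 0) le_rfl
  have hR' : Measurable R := hR.mono (𝓕.le 0) le_rfl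
  have hFj := fun j => measurable_freeTime (a := a) 𝓕 hU hM hR j
  set E := {ω | R ω < n * a ∧ n * a ≤ freeTime a (M ω) (R ω) (fun i => U i ω) (n + M ω)} with hE
  have hEm : MeasurableSet E := by
    have h1 : Measurable fun q : ℕ × Ω =>
        freeTime a (M q.2) (R q.2) (fun i => U i q.2) (n + q.1) :=
      measurable_from_prod_countable_right fun j => (hFj (n + j)).mono (𝓕.le _) le_rfl
    have h2 : Measurable fun ω => freeTime a (M ω) (R ω) (fun i => U i ω) (n + M ω) :=
      h1.comp (hM'.prodMk measurable_id)
    exact (measurableSet_lt hR' measurable_const).inter (measurableSet_le measurable_const h2)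
  let t : ℕ → ℕ → Ω → ℝ := fun j i ω => busyTime a (M ω) (R ω) (fun i => U i ω) n j i
  -- On `D j` the `j`-th service begins before `n * a`, and `Y j` is its age when client `n`
  -- arrives.
  let D : ℕ → Set Ω := fun j =>
    {ω | freeTime a (M ω) (R ω) (fun i => U i ω) j < n * a ∧ j < n + M ω}
  let Y : ℕ → Ω → ℝ := fun j ω =>
    n * a - max (freeTime a (M ω) (R ω) (fun i => U i ω) j) (((j : ℝ) - M ω) * a)
  have hMj : ∀ j, Measurable[𝓕 j] M := fun j => hM.mono (𝓕.mono (Nat.zero_le _)) le_rfl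
  have hD : ∀ j, MeasurableSet[𝓕 j] (D j) := fun j =>
    (measurableSet_lt (hFj j) measurable_const).inter
      (hMj j (DiscreteMeasurableSpace.forall_measurableSet {m | j < n + m}))
  have hY : ∀ j, Measurable[𝓕 j] (Y j) := fun j =>
    measurable_const.sub ((hFj j).max
      ((Measurable.of_discrete (f := fun m : ℕ => (((j : ℝ) - (m : ℝ)) * a))).comp (hMj j)))
  have hDY : ∀ j ω, (D j).indicator (1 : Ω → ℝ≥0∞) ω ≠ 0 → 0 ≤ Y j ω := by
    intro j ω h
    have hω : ω ∈ D j := by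
      by_contra hcon
      exact h (indicator_of_notMem hcon _)
    refine sub_nonneg.2 (max_le hω.1.le (mul_le_mul_of_nonneg_right ?_ ha.le))
    have : (j : ℝ) ≤ ((n + M ω : ℕ) : ℝ) := by exact_mod_cast hω.2.le
    push_cast at this
    linarith
  have hchain : ∀ j k {g : ℝ → ℝ≥0∞}, Measurable g →
      ∫⁻ ω, (D j).indicator 1 ω * (staysAbove a (t j) k).indicator 1 ω * g (t j k ω) ∂P =
        (∫⁻ ω, (D j).indicator 1 ω * ENNReal.ofReal (Real.exp (-(μ * Y j ω))) ∂P) *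
          ∫⁻ x in Ici (k * a), ENNReal.ofReal (ballotDensity a μ k x) * g x := fun j k g hg =>
    lintegral_staysAbove (P := P) ha hμ 𝓕 hU hind hlaw
      ((measurable_const (a := (1 : ℝ≥0∞))).indicator (hD j)) (hY j) (hDY j) k hg
      (t := t j) rfl (fun _ => rfl)
  let C : ℕ → ℝ≥0∞ := fun j =>
    ∫⁻ ω, (D j).indicator 1 ω * ENNReal.ofReal (Real.exp (-(μ * Y j ω))) ∂P
  have htm : ∀ j i, Measurable (t j i) := by
    intro j i
    induction i with
    | zero => exact ((hY j).mono (𝓕.le _) le_rfl).neg.add (hUm j)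
    | succ i ih => exact ih.add (hUm _)
  have hsm : ∀ j k, MeasurableSet (staysAbove a (t j) k) := by
    intro j k
    have : staysAbove a (t j) k = t j 0 ⁻¹' Ici 0 ∩
        ⋂ i ∈ Iio k, t j i ⁻¹' Ici ((i + 1) * a) := by
      ext ω; simp [staysAbove]
    rw [this]
    exact (htm j 0 measurableSet_Ici).inter
      (MeasurableSet.biInter (to_countable _) fun i _ => htm j i measurableSet_Ici)
  have hterm : ∀ j k {g : ℝ → ℝ≥0∞}, Measurable g → Measurable fun ω =>
      (D j).indicator 1 ω * (staysAbove a (t j) k).indicator 1 ω * g (t j k ω) :=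
    fun j k g hg => ((measurable_one.indicator (𝓕.le j _ (hD j))).mul
      (measurable_one.indicator (hsm j k))).mul (hg.comp (htm j k))
  have havg := ae_tendsto_average hμ 𝓕 hU hind hlaw
  have hc : 1 / μ < a := by rwa [div_lt_iff₀ hμ]
  have hU0 : ∀ᵐ ω ∂P, ∀ i, 0 ≤ U i ω := by
    filter_upwards [hS0] with ω hω i
    rw [hUeq]; exact hω _
  -- The chain formula with `k = 0` and `g = 1`: on `E` exactly one `j` contributes. The same
  -- constants `C j` occur in the joint law, so they factor out as `P E`.
  have hocc : P E = ∑' j, C j := by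
    rw [← lintegral_indicator_one hEm]
    have h1 : ∫⁻ ω, E.indicator 1 ω ∂P = ∫⁻ ω, ∑' j,
        (D j).indicator 1 ω * (staysAbove a (t j) 0).indicator 1 ω *
          (fun _ : ℝ => (1 : ℝ≥0∞)) (t j 0 ω) ∂P := by
      refine lintegral_congr_ae ?_
      filter_upwards [hU0] with ω hω
      by_cases hωE : ω ∈ E
      · obtain ⟨j, hj, hj0⟩ := exists_busyTime_nonneg hωE.1 hωE.2
        rw [indicator_of_mem hωE, tsum_eq_single j]
        · rw [indicator_of_mem (by exact hj),
            indicator_of_mem (by exact ⟨hj0, fun i hi => absurd hi (Nat.not_lt_zero i)⟩)]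
          simp
        · intro j' hj'
          by_cases h1 : ω ∈ D j'
          · rw [indicator_of_notMem (s := staysAbove a (t j') 0), mul_zero, zero_mul]
            exact fun h2 => hj' (eq_of_busyTime_nonneg hω h1.1 h2.1 hj.1 hj0)
          · rw [indicator_of_notMem h1, zero_mul, zero_mul]
      · rw [indicator_of_notMem hωE, eq_comm, ENNReal.tsum_eq_zero]
        intro j
        by_cases h1 : ω ∈ D j
        · rw [indicator_of_notMem (s := staysAbove a (t j) 0), mul_zero, zero_mul]
          exact fun h2 => hωE (occupied_of_busyTime_nonneg hω h1 h2.1)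
        · rw [indicator_of_notMem h1, zero_mul, zero_mul]
    rw [h1, lintegral_tsum fun j => (hterm j 0 measurable_const).aemeasurable]
    refine tsum_congr fun j => ?_
    rw [hchain j 0 (g := fun _ => 1) measurable_const, lintegral_ballotDensity_zero hμ, mul_one]
  rw [hocc, ← ENNReal.tsum_mul_right, ← lintegral_indicator_one (hEm.inter (hW hB))]
  let g : ℕ → ℝ → ℝ≥0∞ := fun k => (Iio (((k : ℝ) + 1) * a) ∩ B).indicator 1
  have hg : ∀ k, Measurable (g k) := fun k =>
    measurable_one.indicator (measurableSet_Iio.inter hB)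
  have h2 : ∀ ω j k, ¬ IsPassage a (M ω) (R ω) (fun i => U i ω) n j k →
      (D j).indicator 1 ω * (staysAbove a (t j) k).indicator 1 ω * g k (t j k ω) = 0 := by
    intro ω j k h
    by_cases h1 : ω ∈ D j
    · by_cases h2 : ω ∈ staysAbove a (t j) k
      · rw [show g k (t j k ω) = 0 from indicator_of_notMem (fun h3 => h ⟨h1, h2, h3.1⟩) _,
          mul_zero]
      · rw [indicator_of_notMem h2, mul_zero, zero_mul]
    · rw [indicator_of_notMem h1, zero_mul, zero_mul]
  -- Almost surely, exactly one pair `(j, k)` is a passage on `E` and none is off `E`, so the double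
  -- series has at most one nonzero term.
  have h3 : ∫⁻ ω, (E ∩ (fun ω => wait a (M ω) (R ω) (fun i => S i ω) n) ⁻¹' B).indicator 1 ω ∂P =
      ∫⁻ ω, ∑' j, ∑' k, (D j).indicator 1 ω * (staysAbove a (t j) k).indicator 1 ω *
        g k (t j k ω) ∂P := by
    refine lintegral_congr_ae ?_
    filter_upwards [hS0, hU0, havg] with ω hSω hω hav
    by_cases hωE : ω ∈ E
    · obtain ⟨j, k, hjk⟩ := exists_isPassage ha hc hav hωE.1 hωE.2
      have hwait : wait a (M ω) (R ω) (fun i => S i ω) n = t j k ω := by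
        have hfun : (fun i => U i ω) = serviceLength a (M ω) (R ω) (fun i => S i ω) :=
          funext fun i => hUeq i ω
        have hjk' := hjk
        rw [hfun] at hjk'
        simp only [t, hfun]
        exact hjk'.wait_eq ha hSω (hR0 ω)
      rw [tsum_eq_single j, tsum_eq_single k]
      · rw [indicator_of_mem (s := D j) hjk.1, indicator_of_mem (s := staysAbove a (t j) k) hjk.2.1,
          Pi.one_apply, one_mul, one_mul]
        by_cases hb : t j k ω ∈ B
        · rw [indicator_of_mem (by exact ⟨hωE, by rw [mem_preimage, hwait]; exact hb⟩)]
          exact (indicator_of_mem (s := Iio (((k : ℝ) + 1) * a) ∩ B) ⟨hjk.2.2, hb⟩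
            (1 : ℝ → ℝ≥0∞)).symm
        · rw [indicator_of_notMem (fun h => hb (by rw [← hwait]; exact h.2))]
          exact (indicator_of_notMem (s := Iio (((k : ℝ) + 1) * a) ∩ B) (fun h => hb h.2)
            (1 : ℝ → ℝ≥0∞)).symm
      · exact fun k' hk' => h2 ω j k' fun h => hk' (h.unique hω hjk).2
      · intro j' hj'
        rw [ENNReal.tsum_eq_zero]
        exact fun k' => h2 ω j' k' fun h => hj' (h.unique hω hjk).1
    · rw [indicator_of_notMem (fun h => hωE h.1), eq_comm, ENNReal.tsum_eq_zero]
      intro j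
      rw [ENNReal.tsum_eq_zero]
      exact fun k => h2 ω j k fun h => hωE (occupied_of_busyTime_nonneg hω h.1 h.2.1.1)
  rw [h3, lintegral_tsum fun j =>
    (Measurable.tsum fun k => hterm j k (hg k)).aemeasurable]
  refine tsum_congr fun j => ?_
  rw [lintegral_tsum fun k => (hterm j k (hg k)).aemeasurable, ← ENNReal.tsum_mul_left]
  exact tsum_congr fun k => hchain j k (hg k)

end Law

/-! ### Passage to the limit -/

section Convergence

open scoped ENNReal
open LIFOQueue

variable {Ω : Type*} {mΩ : MeasurableSpace Ω} {P : Measure Ω} [IsProbabilityMeasure P]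

lemma tendsto_measure_nat_mul_le {a : ℝ} (ha : 0 < a) {R : Ω → ℝ} (hR : Measurable R) :
    Tendsto (fun n : ℕ => P {ω | n * a ≤ R ω}) atTop (𝓝 0) := by
  have h := tendsto_measure_iInter_atTop (μ := P) (s := fun n : ℕ => {ω | n * a ≤ R ω})
    (fun n => (measurableSet_le measurable_const hR).nullMeasurableSet)
    (fun n k hnk ω (hω : (k : ℝ) * a ≤ R ω) => le_trans (mul_le_mul_of_nonneg_right
      (by exact_mod_cast hnk) ha.le) hω) ⟨0, measure_ne_top _ _⟩
  have hempty : ⋂ n : ℕ, {ω | n * a ≤ R ω} = ∅ := by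
    refine eq_empty_of_forall_notMem fun ω hω => ?_
    obtain ⟨n, hn⟩ := exists_nat_gt (R ω / a)
    rw [div_lt_iff₀ ha] at hn
    exact absurd (mem_iInter.1 hω n) (not_le.2 hn)
  rwa [hempty, measure_empty] at h

variable {a μ ζ : ℝ} {M : Ω → ℕ} {R : Ω → ℝ} {S : ℤ → Ω → ℝ}

theorem queue_serviceLength (ha : 0 < a) (hS : ∀ i, Measurable (S i)) (hindep : iIndepFun S P)
    (hlaw : ∀ i, P.map (S i) = expMeasure μ) (hM : Measurable M) (hR : Measurable R)
    (hXS : IndepFun (fun ω => (M ω, R ω)) (fun ω i => S i ω) P) (hR0 : ∀ ω, 0 ≤ R ω)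
    (hS0 : ∀ᵐ ω ∂P, ∀ i, 0 ≤ S i ω) (n : ℕ) :
    Measurable[pastFiltration a hM hR hS (n + 1)]
        (fun ω => serviceLength a (M ω) (R ω) (fun i => S i ω) n) ∧
      Indep (pastFiltration a hM hR hS n) (MeasurableSpace.comap
        (fun ω => serviceLength a (M ω) (R ω) (fun i => S i ω) n) inferInstance) P ∧
      P.map (fun ω => serviceLength a (M ω) (R ω) (fun i => S i ω) n) = expMeasure μ := by
  have hsl : Measurable fun ω => serviceLength a (M ω) (R ω) (fun i => S i ω) n :=
    (measurable_queue_epoch a n).2.2.2.comp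
      (hM.prodMk (hR.prodMk (measurable_pi_lambda _ hS)))
  have hmain := fun {A B} (hA : MeasurableSet A) (hB : MeasurableSet B) =>
    measure_past_inter_serviceLength (P := P) ha hM hR hS hindep hlaw hXS hS0 hR0 n hA hB
  have hmap : P.map (fun ω => serviceLength a (M ω) (R ω) (fun i => S i ω) n) = expMeasure μ := by
    ext B hB
    have h := hmain MeasurableSet.univ hB
    rw [preimage_univ, univ_inter, measure_univ, one_mul] at h
    rw [Measure.map_apply hsl hB, h]
  refine ⟨?_, ?_, hmap⟩
  · have h1 : Measurable fun q : (ℕ × ℝ) × (ℕ → ℝ) => q.2 n :=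
      (measurable_pi_apply n).comp measurable_snd
    have h2 : (fun ω => serviceLength a (M ω) (R ω) (fun i => S i ω) n) =
        (fun q : (ℕ × ℝ) × (ℕ → ℝ) => q.2 n) ∘
          fun ω => past a (n + 1) (M ω, R ω, fun i => S i ω) := by
      funext ω; simp [past]
    rw [h2]
    exact h1.comp (comap_measurable _)
  · have : IndepFun (fun ω => past a n (M ω, R ω, fun i => S i ω))
        (fun ω => serviceLength a (M ω) (R ω) (fun i => S i ω) n) P := by
      rw [indepFun_iff_measure_inter_preimage_eq_mul]
      intro A B hA hB
      rw [hmain hA hB, ← hmap, Measure.map_apply hsl hB]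
    exact this

theorem tendsto_map_wait (ha : 0 < a) (hμ : 0 < μ) (hstable : 1 < a * μ) (hζ0 : 0 < ζ)
    (hζ1 : ζ < 1) (hζ : ζ = Real.exp (-a * μ * (1 - ζ))) (hS : ∀ i, Measurable (S i))
    (hindep : iIndepFun S P) (hlaw : ∀ i, P.map (S i) = expMeasure μ) (hM : Measurable M)
    (hR : Measurable R) (hXS : IndepFun (fun ω => (M ω, R ω)) (fun ω i => S i ω) P)
    (hR0 : ∀ ω, 0 ≤ R ω) :
    (∀ᵐ ω ∂P, ∀ n : ℕ, ∃ j : ℕ, client a (M ω) (R ω) (fun i => S i ω) j = n) ∧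
    ∀ B : Set ℝ, MeasurableSet B →
      Tendsto (fun n : ℕ => P.map (fun ω => wait a (M ω) (R ω) (fun i => S i ω) n) B) atTop
        (𝓝 (atomPlusDensity (1 - ζ) (waitDensity a μ ζ) B)) := by
  have hζ' : ζ = Real.exp (-(a * (μ * (1 - ζ)))) := by
    rw [show -(a * (μ * (1 - ζ))) = -a * μ * (1 - ζ) by ring]; exact hζ
  have hS0 : ∀ᵐ ω ∂P, ∀ i, 0 ≤ S i ω := by
    rw [ae_all_iff]
    intro i
    have h := expMeasure_ae_nonneg hμ
    rw [← hlaw i] at h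
    exact ae_of_ae_map (hS i).aemeasurable h
  have hp : Measurable fun ω => (M ω, R ω, fun i => S i ω) :=
    hM.prodMk (hR.prodMk (measurable_pi_lambda _ hS))
  set 𝓕 := pastFiltration a hM hR hS
  let U : ℕ → Ω → ℝ := fun n ω => serviceLength a (M ω) (R ω) (fun i => S i ω) n
  have hq := queue_serviceLength ha hS hindep hlaw hM hR hXS hR0 hS0
  have hU : ∀ n, Measurable[𝓕 (n + 1)] (U n) := fun n => (hq n).1
  have hind : ∀ n, Indep (𝓕 n) (MeasurableSpace.comap (U n) inferInstance) P :=
    fun n => (hq n).2.1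
  have hUlaw : ∀ n, P.map (U n) = expMeasure μ := fun n => (hq n).2.2
  have hX : Measurable[𝓕 0] fun ω => (M ω, R ω) :=
    measurable_fst.comp (comap_measurable fun ω => past a 0 (M ω, R ω, fun i => S i ω))
  have hM0 : Measurable[𝓕 0] M := measurable_fst.comp hX
  have hRm0 : Measurable[𝓕 0] R := measurable_snd.comp hX
  have hc : 1 / μ < a := by rwa [div_lt_iff₀ hμ]
  refine ⟨?_, fun B hB => ?_⟩
  · filter_upwards [hS0, ae_tendsto_average hμ 𝓕 hU hind hUlaw] with ω hω hav n
    exact exists_client_eq ha hω (hR0 ω) hc hav n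
  let W : ℕ → Ω → ℝ := fun n ω => wait a (M ω) (R ω) (fun i => S i ω) n
  have hW : ∀ n, Measurable (W n) := fun n => (measurable_wait a n).comp hp
  let O : ℕ → Set Ω := fun n => {ω | n * a ≤ freeTime a (M ω) (R ω) (fun i => U i ω) (n + M ω)}
  let E : ℕ → Set Ω := fun n =>
    {ω | R ω < n * a ∧ n * a ≤ freeTime a (M ω) (R ω) (fun i => U i ω) (n + M ω)}
  have hOm : ∀ n, MeasurableSet (O n) := by
    intro n
    have h1 : Measurable fun q : ℕ × Ω =>
        freeTime a (M q.2) (R q.2) (fun i => U i q.2) (n + q.1) :=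
      measurable_from_prod_countable_right fun j =>
        (measurable_freeTime 𝓕 hU hM0 hRm0 (n + j)).mono (𝓕.le _) le_rfl
    exact measurableSet_le measurable_const (h1.comp (hM.prodMk measurable_id))
  have hO : Tendsto (fun n => P (O n)) atTop (𝓝 (ENNReal.ofReal ζ)) :=
    tendsto_measure_occupied ha hμ hstable hζ0 hζ1 hζ' 𝓕 hU hind hUlaw hM0 hRm0
  have hRlim := tendsto_measure_nat_mul_le (P := P) ha hR
  have hRm : ∀ n : ℕ, MeasurableSet {ω | n * a ≤ R ω} := fun n =>
    measurableSet_le measurable_const hR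
  have hEO : ∀ n, O n \ {ω | n * a ≤ R ω} = E n := fun n => by
    ext ω
    simp only [O, E, Set.mem_sdiff, mem_ofPred_eq, not_le]
    exact and_comm
  have hElim : Tendsto (fun n => P (E n)) atTop (𝓝 (ENNReal.ofReal ζ)) := by
    refine tendsto_of_tendsto_of_tendsto_of_le_of_le
      (g := fun n => P (O n) - P {ω | n * a ≤ R ω}) ?_ hO (fun n => ?_)
      (fun n => measure_mono fun ω hω => hω.2)
    · simpa using ENNReal.Tendsto.sub hO hRlim (Or.inl ENNReal.ofReal_ne_top)
    · rw [tsub_le_iff_right, ← hEO n]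
      refine (measure_mono ?_).trans (measure_union_le _ _)
      intro ω hω
      by_cases h : n * a ≤ R ω
      · exact Or.inr h
      · exact Or.inl ⟨hω, h⟩
  set L := ∑' k : ℕ, ∫⁻ x in Ici (k * a), ENNReal.ofReal (ballotDensity a μ k x) *
    (Iio (((k : ℝ) + 1) * a) ∩ B).indicator 1 x with hL
  -- Client `n` arrives during a service of the queue, during the initial residual service, or at an
  -- idle server. The first case has the exact conditional law `L`, the second disappears in the
  -- limit, the third gives the atom.
  have hdecomp : ∀ n, P.map (W n) B = P (E n) * L +
      P (W n ⁻¹' B ∩ O n ∩ {ω | n * a ≤ R ω}) + P (O n)ᶜ * Measure.dirac 0 B := by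
    intro n
    rw [Measure.map_apply (hW n) hB, ← measure_inter_add_sdiff (W n ⁻¹' B) (hOm n),
      ← measure_inter_add_sdiff (W n ⁻¹' B ∩ O n) (hRm n), add_comm (P (_ ∩ _ ∩ _))]
    congr 1
    · congr 1
      rw [inter_sdiff_assoc, hEO, inter_comm]
      exact measure_wait_inter_occupied ha hμ hstable 𝓕 (fun _ _ => rfl) hU hind hUlaw hM0 hRm0
        hR0 hS0 n hB (hW n)
    · have h0 : ∀ᵐ ω ∂P, ω ∈ (O n)ᶜ → W n ω = 0 := by
        filter_upwards [hS0] with ω hω hωO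
        exact wait_eq_zero ha hω (hR0 ω) (not_le.1 hωO)
      rw [Measure.dirac_apply' _ hB]
      by_cases hb : (0 : ℝ) ∈ B
      · rw [indicator_of_mem hb, Pi.one_apply, mul_one]
        refine measure_congr (eventuallyEq_set.2 ?_)
        filter_upwards [h0] with ω hω
        refine ⟨fun h => h.2, fun h => ⟨?_, h⟩⟩
        rw [mem_preimage, hω h]; exact hb
      · rw [indicator_of_notMem hb, mul_zero]
        refine measure_eq_zero_iff_ae_notMem.2 ?_
        filter_upwards [h0] with ω hω h
        refine hb ?_
        rw [← hω h.2]; exact h.1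
  have htarget : atomPlusDensity (1 - ζ) (waitDensity a μ ζ) B =
      ENNReal.ofReal ζ * L + 0 + ENNReal.ofReal (1 - ζ) * Measure.dirac 0 B := by
    rw [atomPlusDensity, Measure.add_apply, Measure.smul_apply, withDensity_apply _ hB,
      lintegral_waitDensity ha hζ0 hB, add_zero, add_comm, smul_eq_mul]
  rw [htarget]
  refine Tendsto.congr (fun n => (hdecomp n).symm) ?_
  refine ((ENNReal.Tendsto.mul_const hElim (Or.inl ?_)).add ?_).add
    (ENNReal.Tendsto.mul_const ?_ (Or.inr ?_))
  · simpa using hζ0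
  · exact tendsto_of_tendsto_of_tendsto_of_le_of_le tendsto_const_nhds hRlim
      (fun _ => zero_le) (fun n => measure_mono inter_subset_right)
  · have : ∀ n, P (O n)ᶜ = 1 - P (O n) := fun n => prob_compl_eq_one_sub (hOm n)
    simp_rw [this]
    rw [ENNReal.ofReal_sub _ hζ0.le, ENNReal.ofReal_one]
    exact ENNReal.Tendsto.sub tendsto_const_nhds hO (Or.inl ENNReal.one_ne_top)
  · exact measure_ne_top _ _

end Convergence

/-! ### The equilibrium theorem -/

theorem mainTheorem1 (a μ : ℝ) (ha : 0 < a) (hμ : 0 < μ) (hstable : 1 < a * μ) :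
    ∃ ζ₀ : ℝ, (0 < ζ₀ ∧ ζ₀ < 1 ∧ ζ₀ = Real.exp (-a * μ * (1 - ζ₀))) ∧
      (∀ z : ℝ, 0 < z → z < 1 → z = Real.exp (-a * μ * (1 - z)) → z = ζ₀) ∧
      ∃ f : ℝ → ℝ, Measurable f ∧
        (∀ x : ℝ, x ≤ 0 → f x = 0) ∧
        (∀ k : ℕ, ∀ x ∈ Ioo (k * a) ((k + 1) * a),
          f x = μ ^ (k + 1) * ζ₀ * x ^ ((k : ℤ) - 1) * (x - k * a) * Real.exp (-μ * x)
            / (Nat.factorial k : ℝ)) ∧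
        (∀ x ∈ Ioo 0 a, f x = μ * ζ₀ * Real.exp (-μ * x)) ∧
        (∀ k : ℕ, 1 ≤ k → Tendsto f (𝓝[>] (k * a)) (𝓝 0)) ∧
        ∀ (Ω : Type*) [MeasurableSpace Ω] (P : Measure Ω) [IsProbabilityMeasure P]
          -- service lengths: independent, exponential with mean `1 / μ`
          (S : ℤ → Ω → ℝ) (_ : ∀ i, Measurable (S i)) (_ : iIndepFun S P)
          (_ : ∀ i, P.map (S i) = expMeasure μ)
          -- initial state: any number of waiting clients, any residual service time
          (M : Ω → ℕ) (R : Ω → NNReal) (_ : Measurable M) (_ : Measurable R)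
          (_ : IndepFun (fun ω => (M ω, R ω)) (fun ω i => S i ω) P),
          -- almost surely every client is served
          (∀ᵐ ω ∂P, ∀ n : ℕ, ∃ j : ℕ,
            LIFOQueue.client a (M ω) (R ω) (fun i => S i ω) j = n) ∧
          -- the waiting time of the `n`-th client converges in law, on every Borel set
          (∀ B : Set ℝ, MeasurableSet B →
            Tendsto
              (fun n : ℕ =>
                P.map (fun ω => LIFOQueue.wait a (M ω) (R ω) (fun i => S i ω) n) B)
              atTop (𝓝 (atomPlusDensity (1 - ζ₀) f B))) ∧
          -- in a stationary queue every waiting time has exactly this law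
          ((∀ n : ℕ, P.map (fun ω => LIFOQueue.wait a (M ω) (R ω) (fun i => S i ω) n)
              = P.map (fun ω => LIFOQueue.wait a (M ω) (R ω) (fun i => S i ω) 0)) →
            ∀ n : ℕ, P.map (fun ω => LIFOQueue.wait a (M ω) (R ω) (fun i => S i ω) n)
              = atomPlusDensity (1 - ζ₀) f) := by

  obtain ⟨ζ, ⟨hζ0, hζ1, hζ⟩, huniq⟩ := existsUnique_root hstable
  simp only [← neg_mul] at hζ huniq
  refine ⟨ζ, ⟨hζ0, hζ1, hζ⟩, huniq, waitDensity a μ ζ, measurable_waitDensity,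
    fun x hx => if_pos hx, fun k x hx => waitDensity_of_mem_Ioo ha hx, fun x hx => ?_,
    fun k hk => tendsto_waitDensity ha hk, ?_⟩
  · rw [waitDensity_of_mem_Ico (k := 0) ha hx.1 (by simpa using ⟨hx.1.le, hx.2⟩)]
    simp only [ballotDensity, ballotVolume, zero_add, pow_one, mul_one, neg_mul]
    ring
  · intro Ω _ P _ S hS hindep hlaw M R hM hR hXS
    have hRm : Measurable fun ω => (R ω : ℝ) := measurable_coe_nnreal_real.comp hR
    have hXS' : IndepFun (fun ω => (M ω, (R ω : ℝ))) (fun ω i => S i ω) P :=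
      hXS.comp (measurable_fst.prodMk (measurable_coe_nnreal_real.comp measurable_snd))
        measurable_id
    obtain ⟨hserved, hlim⟩ := tendsto_map_wait ha hμ hstable hζ0 hζ1 hζ hS hindep hlaw hM hRm hXS'
      fun ω => (R ω).2
    refine ⟨hserved, hlim, fun hstat n => ?_⟩
    ext B hB
    have h := hlim B hB
    -- In a stationary queue the convergent sequence is constant, so its value is the limit.
    simp_rw [hstat] at h
    rw [hstat n]
    exact tendsto_nhds_unique tendsto_const_nhds h
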